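/- Let $k$ be a perfect field of positive characteristic $p$, and let $A\subset B$ be a homogeneous integral extension of positively graded Noetherian $k$-domains of Krull dimension two; here a positively graded $k$-algebra is an $\mathbb N$-graded $k$-algebra $C=\bigoplus_{i\ge 0}C_i$ whose degree zero part $C_0$ is finite-dimensional over $k$ (for instance $C_0=k$), and homogeneous means that $A_i\subset B_i$ for all $i$. Assume that $A$ is normal and contains a nonzero linear form (an element of $A_1\setminus\{0\}$), and that the field extension $\mathrm{Quot}(A)\subset\mathrm{Quot}(B)$ is purely inseparable of degree $p^e$. Write $B^{p^e}=\{b^{p^e}\mid b\in B\}$ and $A^{(p^e)}=\bigoplus_{i\ge 0}A_{p^e i}$, both regarded as subrings of $B$. Then $B^{p^e}\subset A^{(p^e)}$, and this is a finite birational extension; that is, $A^{(p^e)}$ is a finite $B^{p^e}$-module and the two rings have the same quotient field. Moreover, $B$ is normal if and only if $B^{p^e}=A^{(p^e)}$, and in this case \[\left\lfloor \frac{a(A)}{p^e}\right\rfloor = a(B).\] Here, for a positively graded Noetherian $k$-domain $C$ of dimension $d$ with homogeneous maximal ideal $\mathfrak m=\bigoplus_{i>0}C_i$, the $a$-invariant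 $a(C)$ is the largest degree in which the local cohomology module $H^d_{\mathfrak m}(C)$ is nonzero. -/

import Mathlib

noncomputable section

/-- The `n`-th Veronese subalgebra `⨁ᵢ A_{n i}` of a graded algebra `A = ⨁ᵢ Aᵢ`. -/
def veronese {k A : Type*} [Field k] [CommRing A] [Algebra k A]
    (𝒜 : ℕ → Submodule k A) [GradedAlgebra 𝒜] (n : ℕ) : Subalgebra k A :=
  Submodule.toSubalgebra (⨆ i : ℕ, 𝒜 (n * i))
    (Submodule.mem_iSup_of_mem 0 (by simpa using SetLike.GradedOne.one_mem (A := 𝒜)))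
    (by
      intro x y hx hy
      induction hx using Submodule.iSup_induction' with
      | zero => simp
      | add x₁ x₂ _ _ h₁ h₂ => rw [add_mul]; exact add_mem h₁ h₂
      | mem i x hx =>
        induction hy using Submodule.iSup_induction' with
        | zero => simp
        | add y₁ y₂ _ _ h₁ h₂ => rw [mul_add]; exact add_mem h₁ h₂
        | mem j y hy =>
          refine Submodule.mem_iSup_of_mem (i + j) ?_
          rw [mul_add]
          exact SetLike.GradedMul.mul_mem hx hy)

/-- The subring `B^{p^e} = {b ^ (p ^ e) | b ∈ B}` of a nonzero algebra `B` over a field `k` of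
characteristic `p`: the image of the `e`-th iterate of the Frobenius endomorphism. -/
def frobeniusPower (k B : Type*) [Field k] [CommRing B] [Nontrivial B] [Algebra k B]
    (p e : ℕ) [Fact p.Prime] [CharP k p] : Subring B :=
  haveI : ExpChar B p := expChar_of_injective_algebraMap (algebraMap k B).injective p
  (iterateFrobenius B p e).range

/-- For subrings `S`, `T` of a domain: `S ⊆ T`, the ring `T` is a finite `S`-module, and the
inclusion induces an isomorphism of quotient fields. -/
def IsFiniteBirational {B : Type*} [CommRing B] [IsDomain B] (S T : Subring B) : Prop :=
  ∃ h : S ≤ T, (Subring.inclusion h).Finite ∧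
    Function.Bijective
      (IsFractionRing.map (Subring.inclusion_injective h) : FractionRing S →+* FractionRing T)

namespace GradedCech

variable {k A : Type*} [Field k] [CommRing A] [Algebra k A]

/-- A homogeneous system of parameters `f₁, …, f_d`, `deg fᵢ = δᵢ`, of a graded domain whose degree
zero part is a field: `d = dim A` homogeneous elements that generate the homogeneous maximal ideal
`⨁_{i > 0} Aᵢ` up to radical. -/
structure IsHomogeneousSOP (𝒜 : ℕ → Submodule k A) [GradedAlgebra 𝒜] {d : ℕ}
    (f : Fin d → A) (δ : Fin d → ℕ) : Prop where
  dim_eq : ringKrullDim A = d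
  mem : ∀ i, f i ∈ 𝒜 (δ i)
  radical_eq : (Ideal.span (Set.range f)).radical = (HomogeneousIdeal.irrelevant 𝒜).toIdeal

theorem isUnit_face {d : ℕ} (f : Fin d → A) (i : Fin d)
    (y : Submonoid.powers (∏ l ∈ Finset.univ.erase i, f l)) :
    IsUnit (Algebra.ofId A (Localization.Away (∏ l, f l)) (y : A)) := by
  obtain ⟨_, n, rfl⟩ := y
  have h : IsUnit (algebraMap A (Localization.Away (∏ l, f l)) (∏ l, f l)) :=
    IsLocalization.Away.algebraMap_isUnit _
  have e : algebraMap A (Localization.Away (∏ l, f l)) (∏ l, f l) =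
      algebraMap A (Localization.Away (∏ l, f l)) (∏ l ∈ Finset.univ.erase i, f l) *
        algebraMap A (Localization.Away (∏ l, f l)) (f i) := by
    rw [← map_mul, Finset.prod_erase_mul _ f (Finset.mem_univ i)]
  rw [e] at h
  have h' := (isUnit_of_mul_isUnit_left h).pow n
  rw [← map_pow] at h'
  exact h'

/-- The localization map `A_{f₁ ⋯ f̂ᵢ ⋯ f_d} → A_{f₁ ⋯ f_d}`; up to sign, these are the components
of the last differential of the Čech complex of `f₁, …, f_d`. -/
def faceMap {d : ℕ} (f : Fin d → A) (i : Fin d) :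
    Localization.Away (∏ l ∈ Finset.univ.erase i, f l) →ₐ[A] Localization.Away (∏ l, f l) :=
  IsLocalization.liftAlgHom (M := Submonoid.powers (∏ l ∈ Finset.univ.erase i, f l))
    (f := Algebra.ofId A (Localization.Away (∏ l, f l))) (isUnit_face f i)

/-- The image of the last differential of the Čech complex of `f₁, …, f_d`. -/
def boundary {d : ℕ} (f : Fin d → A) : Submodule A (Localization.Away (∏ l, f l)) :=
  ⨆ i, LinearMap.range (faceMap f i).toLinearMap

/-- The `d`-th cohomology of the Čech complex
`0 → A → ⨁ᵢ A_{fᵢ} → ⋯ → ⨁ᵢ A_{f₁ ⋯ f̂ᵢ ⋯ f_d} → A_{f₁ ⋯ f_d} → 0`.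
If `f₁, …, f_d` generate the ideal `𝔪` up to radical and `A` is Noetherian, this is the local
cohomology module `H^d_𝔪(A)`. -/
abbrev TopCohomology {d : ℕ} (f : Fin d → A) : Type _ :=
  Localization.Away (∏ l, f l) ⧸ boundary f

/-- The degree `j` component (`j ∈ ℤ`) of the localization `A_F` at a homogeneous element `F` of
degree `Δ`: it is generated by the fractions `a / F ^ t` with `a` homogeneous of degree
`j + t Δ`. -/
def awayComponent (𝒜 : ℕ → Submodule k A) (F : A) (Δ : ℕ) (j : ℤ) :
    AddSubgroup (Localization.Away F) :=
  AddSubgroup.closure {z | ∃ (t i : ℕ) (a : A), a ∈ 𝒜 i ∧ (i : ℤ) = j + t * Δ ∧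
    z = Localization.mk a (⟨F ^ t, t, rfl⟩ : Submonoid.powers F)}

/-- The degree `j` component of the graded module `H^d_𝔪(A)`: the image of the degree `j` component
of `A_{f₁ ⋯ f_d}`. -/
def topComponent (𝒜 : ℕ → Submodule k A) {d : ℕ} (f : Fin d → A) (δ : Fin d → ℕ) (j : ℤ) :
    AddSubgroup (TopCohomology f) :=
  (awayComponent 𝒜 (∏ l, f l) (∑ l, δ l) j).map (boundary f).mkQ.toAddMonoidHom

end GradedCech

open GradedCech in
/-- `a` is the `a`-invariant of the graded domain `A` (Noetherian, with degree zero part a field):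
the largest degree in which the local cohomology module `H^d_𝔪(A)` is nonzero, where `d = dim A`
and `𝔪` is the homogeneous maximal ideal. The module `H^d_𝔪(A)` is computed by the Čech complex of
a homogeneous system of parameters; such systems have to exist, and all of them have to give the
value `a`. -/
def IsAInvariant {k A : Type*} [Field k] [CommRing A] [Algebra k A]
    (𝒜 : ℕ → Submodule k A) [GradedAlgebra 𝒜] (a : ℤ) : Prop :=
  (∃ (d : ℕ) (f : Fin d → A) (δ : Fin d → ℕ), IsHomogeneousSOP 𝒜 f δ) ∧
    ∀ (d : ℕ) (f : Fin d → A) (δ : Fin d → ℕ), IsHomogeneousSOP 𝒜 f δ →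
      IsGreatest {j : ℤ | topComponent 𝒜 f δ j ≠ ⊥} a

end

/-!
Put `q = p ^ e`. Every `b ^ q` lies in `K` and is integral over the normal ring `A`, so it lies in
`A`, in degrees divisible by `q` (`exists_algebraMap_eq_pow`, `mem_veronese_of_algebraMap_eq_pow`).
Since `k` is perfect, `B` is finite over `B ^ q`, and so is the submodule `A^(q)`.

*Birationality.* `A` is finite over `k[x, g]` for a homogeneous system of parameters `x, g`.
Counting degrees along `E ^ q ⊆ M ^ q ⊆ L ^ q ⊆ M` and `E ^ q ⊆ E ⊆ M`, with `E = k(x, g)` and `M`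
the image of `K` in `L`, gives `[M : L ^ q] ≤ q` (`relfinrank_fieldRange_iterateFrobenius_le`). If
`x` is linear, the `q` powers `x ^ i`, `i < q`, are independent over `L ^ q`, as they lie in
different degrees modulo `q`; hence they form a basis of `M` over `L ^ q`, and for the same reason
an element of `A^(q)` has only a constant coefficient. So `A^(q) ⊆ L ^ q`
(`exists_eq_pow_of_mem_veronese`).

*Normality.* If `B` is normal, the `q`-th root in `L` of an element of `A^(q)` is in `B`.
Conversely, if `B ^ q = A^(q)` and `z` is integral over `B`, then `z ^ q` is an element of `A`
which is a quotient of elements of `A^(q)`, hence is in `A^(q)` and has its root in `B`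
(`isIntegrallyClosed_of_exists_root`).

*The `a`-invariants.* In a normal graded domain of dimension two a homogeneous system of parameters
`f, g` is a regular sequence (`isRegularModulo_of_radical_eq`). Therefore a fraction
`a / (f g) ^ t` represents zero in the top Čech cohomology if and only if `a ∈ (f ^ t, g ^ t)`, and
the largest degree of a nonzero class is `N - deg f - deg g`, where `N` is the top degree of
`A / (f, g)`. By the Koszul complex this number is determined by the Hilbert function, so it does
not depend on `f, g` (`IsTopDegree.le_of_isTopDegree`). If `B ^ q = A^(q)`, the Frobenius
identifies the degree `j` part of the top cohomology of `B` with the degree `q j` part of that of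
`A` (`topNonzero_iff_of_frobenius`). As a linear parameter acts surjectively on the top cohomology
of `A`, the latter is nonzero in all degrees `≤ a(A)`, and `a(B)` is the largest `j` with
`q j ≤ a(A)`.
-/

open DirectSum

/-! ### Homogeneous components indexed by integers -/

section IntegerDegrees

variable {k A : Type*} [Field k] [CommRing A] [Algebra k A]

/-- The component of degree `n ∈ ℤ` of an `ℕ`-graded algebra; it is zero for `n < 0`. -/
def intPart (𝒜 : ℕ → Submodule k A) (n : ℤ) : Submodule k A :=
  if 0 ≤ n then 𝒜 n.toNat else ⊥

variable (𝒜 : ℕ → Submodule k A)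

theorem intPart_natCast (n : ℕ) : intPart 𝒜 n = 𝒜 n := by
  simp [intPart]

theorem intPart_of_neg {n : ℤ} (hn : n < 0) : intPart 𝒜 n = ⊥ := by
  simp [intPart, not_le.2 hn]

variable {𝒜}

theorem mem_intPart_of_eq {n : ℤ} {i : ℕ} (h : (i : ℤ) = n) {a : A} (ha : a ∈ 𝒜 i) :
    a ∈ intPart 𝒜 n := by
  rw [← h, intPart_natCast]; exact ha

theorem mem_intPart_cases {n : ℤ} {a : A} (ha : a ∈ intPart 𝒜 n) :
    a = 0 ∨ ∃ i : ℕ, (i : ℤ) = n ∧ a ∈ 𝒜 i := by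
  unfold intPart at ha
  split_ifs at ha with h
  · exact Or.inr ⟨n.toNat, Int.toNat_of_nonneg h, ha⟩
  · exact Or.inl (by simpa using ha)

variable [GradedAlgebra 𝒜]

theorem mul_mem_intPart {d : ℕ} {n m : ℤ} {g a : A} (hg : g ∈ 𝒜 d) (ha : a ∈ intPart 𝒜 n)
    (h : d + n = m) : g * a ∈ intPart 𝒜 m := by
  rcases mem_intPart_cases ha with rfl | ⟨i, hi, ha⟩
  · simp
  · exact mem_intPart_of_eq (i := d + i) (by push_cast; omega) (SetLike.mul_mem_graded hg ha)

theorem coe_decompose_sum {ι : Type*} (s : Finset ι) (f : ι → A) (n : ℕ) :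
    (decompose 𝒜 (∑ i ∈ s, f i) n : A) = ∑ i ∈ s, (decompose 𝒜 (f i) n : A) := by
  rw [decompose_sum, DFinsupp.finsetSum_apply, AddSubmonoidClass.coe_finsetSum]

/-- The degree `n` component of a multiple of a homogeneous element `g` is a homogeneous multiple of
`g`, possibly zero. -/
theorem exists_decompose_mul {d : ℕ} {g : A} (hg : g ∈ 𝒜 d) (u : A) (n : ℕ) :
    ∃ w ∈ intPart 𝒜 ((n : ℤ) - d), (decompose 𝒜 (g * u) n : A) = g * w := by
  by_cases h : d ≤ n
  · exact ⟨decompose 𝒜 u (n - d), mem_intPart_of_eq (by omega) (SetLike.coe_mem _),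
      coe_decompose_mul_of_left_mem_of_le 𝒜 hg h⟩
  · exact ⟨0, zero_mem _, by rw [coe_decompose_mul_of_left_mem_of_not_le 𝒜 hg h, mul_zero]⟩

/-- A homogeneous element of an ideal with homogeneous generators is a combination of them with
homogeneous coefficients. -/
theorem exists_homogeneous_coeff {ι : Type*} [Fintype ι] {f : ι → A} {d : ι → ℕ}
    (hf : ∀ i, f i ∈ 𝒜 (d i)) {n : ℤ} {a : A} (ha : a ∈ intPart 𝒜 n)
    (hmem : a ∈ Ideal.span (Set.range f)) :
    ∃ u : ι → A, (∀ i, u i ∈ intPart 𝒜 (n - d i)) ∧ a = ∑ i, f i * u i := by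
  rcases mem_intPart_cases ha with rfl | ⟨m, rfl, ha⟩
  · exact ⟨0, fun i => zero_mem _, by simp⟩
  · obtain ⟨c, hc⟩ := Ideal.mem_span_range_iff_exists_fun.1 hmem
    choose w hw hw' using fun i => exists_decompose_mul (hf i) (c i) m
    refine ⟨w, hw, ?_⟩
    rw [← decompose_of_mem_same 𝒜 ha, ← hc, coe_decompose_sum]
    exact Finset.sum_congr rfl fun i _ => by rw [mul_comm (c i)]; exact hw' i

theorem mem_irrelevant_of_mem_pos {n : ℕ} (hn : 0 < n) {a : A} (ha : a ∈ 𝒜 n) :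
    a ∈ (HomogeneousIdeal.irrelevant 𝒜).toIdeal :=
  HomogeneousIdeal.mem_irrelevant_of_mem 𝒜 hn ha

theorem eq_zero_of_mem_irrelevant {a : A} (ha : a ∈ 𝒜 0)
    (h : a ∈ (HomogeneousIdeal.irrelevant 𝒜).toIdeal) : a = 0 := by
  have := (HomogeneousIdeal.mem_irrelevant_iff 𝒜 a).1 h
  rwa [GradedRing.proj_apply, decompose_of_mem_same 𝒜 ha] at this

theorem irrelevant_isPrime [IsDomain A] : (HomogeneousIdeal.irrelevant 𝒜).toIdeal.IsPrime := by
  rw [HomogeneousIdeal.toIdeal_irrelevant]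
  exact RingHom.ker_isPrime _

theorem mem_of_forall_homogeneous_mem {R : Type*} [SetLike R A] [AddSubmonoidClass R A] (S : R)
    (h : ∀ n, ∀ a ∈ 𝒜 n, a ∈ S) (a : A) : a ∈ S := by
  classical
  rw [← sum_support_decompose 𝒜 a]
  exact sum_mem fun n _ => h n _ (SetLike.coe_mem _)

end IntegerDegrees

/-! ### Noetherian graded algebras and graded Nakayama -/

section Noetherian

variable {k A : Type*} [Field k] [CommRing A] [Algebra k A] (𝒜 : ℕ → Submodule k A)
  [GradedAlgebra 𝒜]

theorem exists_irrelevant_generators [IsNoetherianRing A] :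
    ∃ (r : ℕ) (g : Fin r → A) (d : Fin r → ℕ), (∀ i, 0 < d i) ∧ (∀ i, g i ∈ 𝒜 (d i)) ∧
      Ideal.span (Set.range g) = (HomogeneousIdeal.irrelevant 𝒜).toIdeal := by
  have hfg : (Ideal.span (⋃ i > 0, (𝒜 i : Set A))).FG := IsNoetherian.noetherian _
  obtain ⟨s, hs, hs'⟩ := Submodule.fg_span_iff_fg_span_finset_subset _ |>.1 hfg
  have h : ∀ x : s, ∃ d : ℕ, 0 < d ∧ (x : A) ∈ 𝒜 d := by
    intro x
    have := hs x.2
    simpa using this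
  choose d hd hd' using h
  refine ⟨s.card, fun i => (s.equivFin.symm i : A), fun i => d (s.equivFin.symm i),
    fun i => hd _, fun i => hd' _, ?_⟩
  rw [HomogeneousIdeal.irrelevant_eq_span]
  have : Set.range (fun i => (s.equivFin.symm i : A)) = s := by
    rw [show (fun i => (s.equivFin.symm i : A)) = Subtype.val ∘ s.equivFin.symm from rfl,
      Set.range_comp, s.equivFin.symm.surjective.range_eq]
    simp
  rw [this]
  exact hs'.symm

theorem finite_component [IsNoetherianRing A] [Module.Finite k (𝒜 0)] (n : ℕ) :
    Module.Finite k (𝒜 n) := by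
  obtain ⟨r, g, d, hd, hg, hspan⟩ := exists_irrelevant_generators 𝒜
  induction n using Nat.strong_induction_on with
  | _ n ih =>
  rcases Nat.eq_zero_or_pos n with rfl | hn
  · infer_instance
  have hV : ∀ i, Module.Finite k (intPart 𝒜 ((n : ℤ) - d i)) := by
    intro i
    by_cases h : d i ≤ n
    · rw [show (n : ℤ) - d i = ((n - d i : ℕ) : ℤ) by omega, intPart_natCast]
      exact ih _ (by have := hd i; omega)
    · rw [intPart_of_neg _ (by omega)]
      infer_instance
  have hle : 𝒜 n ≤ ⨆ i, (intPart 𝒜 ((n : ℤ) - d i)).map (LinearMap.mulLeft k (g i)) := by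
    intro a ha
    obtain ⟨u, hu, rfl⟩ := exists_homogeneous_coeff hg (mem_intPart_of_eq rfl ha)
      (hspan ▸ mem_irrelevant_of_mem_pos hn ha)
    exact sum_mem fun i _ => Submodule.mem_iSup_of_mem i ⟨u i, hu i, rfl⟩
  exact Submodule.finiteDimensional_of_le hle

variable {𝒜} in
/-- Homogeneous elements of large degree lie in any ideal whose radical is the irrelevant ideal. -/
theorem exists_forall_ge_mem_of_radical_eq [IsNoetherianRing A] {I : Ideal A}
    (hI : I.radical = (HomogeneousIdeal.irrelevant 𝒜).toIdeal) :
    ∃ N : ℕ, ∀ n ≥ N, ∀ a ∈ 𝒜 n, a ∈ I := by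
  obtain ⟨r, g, d, hd, hg, hspan⟩ := exists_irrelevant_generators 𝒜
  obtain ⟨M, hM⟩ := Ideal.exists_radical_pow_le_of_fg I (IsNoetherian.noetherian _)
  rw [hI] at hM
  set D := ∑ i, d i
  -- `A_n` lies in the `m`-th power of the irrelevant ideal once `n` exceeds `m * D`, since all
  -- generators have degree at most `D`
  have key : ∀ m n : ℕ, m * D < n → ∀ a ∈ 𝒜 n, a ∈ (HomogeneousIdeal.irrelevant 𝒜).toIdeal ^ m := by
    intro m
    induction m with
    | zero => simp
    | succ m ih =>
      intro n hn a ha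
      have hn0 : 0 < n := by omega
      obtain ⟨u, hu, rfl⟩ := exists_homogeneous_coeff hg (mem_intPart_of_eq rfl ha)
        (hspan ▸ mem_irrelevant_of_mem_pos hn0 ha)
      refine sum_mem fun i _ => ?_
      rw [pow_succ']
      refine Ideal.mul_mem_mul (mem_irrelevant_of_mem_pos (hd i) (hg i)) ?_
      rcases mem_intPart_cases (hu i) with h | ⟨j, hj, h⟩
      · rw [h]; exact zero_mem _
      · refine ih j ?_ _ h
        have := Finset.single_le_sum (f := d) (fun _ _ => Nat.zero_le _) (Finset.mem_univ i)
        have : d i ≤ D := this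
        have h2 : (m + 1) * D = m * D + D := by ring
        omega
  exact ⟨M * D + 1, fun n hn a ha => hM (key M n hn a ha)⟩

/-- Graded Nakayama: `A` is finite over the subalgebra generated by homogeneous elements of positive
degree that generate the irrelevant ideal up to radical. -/
theorem finite_adjoin_of_radical_eq [IsNoetherianRing A] [Module.Finite k (𝒜 0)] {s : ℕ}
    {f : Fin s → A} {d : Fin s → ℕ} (hd : ∀ i, 0 < d i) (hf : ∀ i, f i ∈ 𝒜 (d i))
    (hrad : (Ideal.span (Set.range f)).radical = (HomogeneousIdeal.irrelevant 𝒜).toIdeal) :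
    Module.Finite (Algebra.adjoin k (Set.range f)) A := by
  obtain ⟨N, hN⟩ := exists_forall_ge_mem_of_radical_eq hrad
  have : ∀ n, Module.Finite k (𝒜 n) := finite_component 𝒜
  have hfin : (⨆ n : Fin N, 𝒜 n).FG := Submodule.fg_iSup _ fun n => Module.Finite.iff_fg.1 (this n)
  obtain ⟨t, ht⟩ := hfin
  set C := Algebra.adjoin k (Set.range f)
  refine ⟨⟨t, ?_⟩⟩
  have key : ∀ n, ∀ a ∈ 𝒜 n, a ∈ Submodule.span C (t : Set A) := by
    intro n
    induction n using Nat.strong_induction_on with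
    | _ n ih =>
    intro a ha
    by_cases h : n < N
    · have : a ∈ Submodule.span k (t : Set A) := by
        rw [ht]; exact Submodule.mem_iSup_of_mem ⟨n, h⟩ ha
      exact Submodule.span_le_restrictScalars k C _ this
    · obtain ⟨u, hu, rfl⟩ := exists_homogeneous_coeff hf (mem_intPart_of_eq rfl ha)
        (hN n (not_lt.1 h) a ha)
      refine sum_mem fun i _ => ?_
      have hu' : u i ∈ Submodule.span C (t : Set A) := by
        rcases mem_intPart_cases (hu i) with h | ⟨j, hj, h⟩
        · rw [h]; exact zero_mem _
        · exact ih j (by have := hd i; omega) _ h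
      exact Submodule.smul_mem _ (⟨f i, Algebra.subset_adjoin ⟨i, rfl⟩⟩ : C) hu'
  exact eq_top_iff.2 fun a _ => mem_of_forall_homogeneous_mem (𝒜 := 𝒜) _ key a

theorem finiteType_of_isNoetherianRing [IsNoetherianRing A] [IsDomain A] [Module.Finite k (𝒜 0)] :
    Algebra.FiniteType k A := by
  obtain ⟨r, g, d, hd, hg, hspan⟩ := exists_irrelevant_generators 𝒜
  have := finite_adjoin_of_radical_eq 𝒜 hd hg (by rw [hspan, irrelevant_isPrime.radical])
  have : Algebra.FiniteType k (Algebra.adjoin k (Set.range g)) :=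
    Subalgebra.fg_iff_finiteType _ |>.1 ⟨(Set.finite_range g).toFinset, by simp⟩
  exact Algebra.FiniteType.trans (S := Algebra.adjoin k (Set.range g)) this inferInstance

/-- If the irrelevant ideal is the radical of a homogeneous principal ideal `(a)`, then `A` is
integral over `k[a]`, a quotient of a polynomial ring in one variable. This bound replaces Krull's
height theorem below. -/
theorem ringKrullDim_le_one_of_radical_eq [IsNoetherianRing A] [IsDomain A]
    [Module.Finite k (𝒜 0)] {a : A} {d : ℕ} (ha : a ∈ 𝒜 d)
    (hrad : (Ideal.span {a}).radical = (HomogeneousIdeal.irrelevant 𝒜).toIdeal) :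
    ringKrullDim A ≤ 1 := by
  -- in degree zero `a` vanishes, and then it may be given degree one
  have h : ∃ d' > 0, a ∈ 𝒜 d' := by
    rcases Nat.eq_zero_or_pos d with rfl | hd
    · have : a = 0 := eq_zero_of_mem_irrelevant ha
        (hrad ▸ Ideal.le_radical (Ideal.mem_span_singleton_self a))
      exact ⟨1, one_pos, this ▸ zero_mem _⟩
    · exact ⟨d, hd, ha⟩
  obtain ⟨d', hd', ha'⟩ := h
  have hfin := finite_adjoin_of_radical_eq 𝒜 (f := fun _ : Fin 1 => a) (d := fun _ => d')
    (fun _ => hd') (fun _ => ha') (by simpa using hrad)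
  set C := Algebra.adjoin k (Set.range fun _ : Fin 1 => a)
  have h1 : ringKrullDim C ≤ 1 := by
    have hC : (Polynomial.aeval a : Polynomial k →ₐ[k] A).range = C := by
      rw [← Algebra.adjoin_singleton_eq_range_aeval]; simp [C]
    have := ringKrullDim_le_of_surjective
      (Polynomial.aeval a : Polynomial k →ₐ[k] A).rangeRestrict.toRingHom
      (AlgHom.rangeRestrict_surjective _)
    rw [hC] at this
    refine this.trans ?_
    rw [Polynomial.ringKrullDim_of_isNoetherianRing, ringKrullDim_eq_zero_of_field]
    simp
  refine le_trans ?_ h1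
  exact Order.krullDim_le_of_strictMono
    (fun I : PrimeSpectrum A =>
      (⟨I.asIdeal.comap (algebraMap C A), inferInstance⟩ : PrimeSpectrum C))
    fun I J h => Ideal.IsIntegral.comap_lt_comap h

end Noetherian

/-! ### Regular sequences of length two -/

section RegularPairs

/-- `g` is a nonzerodivisor modulo `f`. -/
def IsRegularModulo {A : Type*} [CommRing A] (f g : A) : Prop :=
  ∀ b, f ∣ g * b → f ∣ b

variable {A : Type*} [CommRing A] [IsDomain A] {f g : A}

theorem IsRegularModulo.symm (hf : f ≠ 0) (h : IsRegularModulo f g) : IsRegularModulo g f := by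
  rintro b ⟨c, hc⟩
  obtain ⟨e, rfl⟩ := h c ⟨b, hc.symm⟩
  exact ⟨e, mul_left_cancel₀ hf (by rw [hc]; ring)⟩

omit [IsDomain A] in
theorem IsRegularModulo.pow_right (h : IsRegularModulo f g) (n : ℕ) :
    IsRegularModulo f (g ^ n) := by
  induction n with
  | zero => intro b hb; simpa using hb
  | succ n ih => intro b hb; exact ih b (h _ (by rwa [← mul_assoc, ← pow_succ']))

theorem IsRegularModulo.pow_left (hf : f ≠ 0) (h : IsRegularModulo f g) (n : ℕ) :
    IsRegularModulo (f ^ n) g := by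
  induction n with
  | zero => intro b _; simp
  | succ n ih =>
    intro b hb
    obtain ⟨c, rfl⟩ := h b ((Dvd.intro_left _ (pow_succ f n).symm).trans hb)
    rw [pow_succ'] at hb ⊢
    exact mul_dvd_mul_left f (ih c ((mul_dvd_mul_iff_left hf).1 (by rwa [mul_left_comm] at hb)))

/-- Multiplication by `(f g) ^ s` is injective from `A / (f ^ t, g ^ t)` to
`A / (f ^ (t + s), g ^ (t + s))`. -/
theorem IsRegularModulo.mem_span_of_mul_mem (hf : f ≠ 0) (hg : g ≠ 0) (h : IsRegularModulo f g)
    {s t : ℕ} {a : A} (ha : a * (f * g) ^ s ∈ Ideal.span {f ^ (t + s), g ^ (t + s)}) :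
    a ∈ Ideal.span {f ^ t, g ^ t} := by
  obtain ⟨u, v, huv⟩ := Ideal.mem_span_pair.1 ha
  obtain ⟨v', rfl⟩ := ((h.pow_left hf s).pow_right (t + s)) v
    ⟨a * g ^ s - u * f ^ t, by linear_combination huv⟩
  obtain ⟨u', rfl⟩ := (((h.symm hf).pow_left hg s).pow_right (t + s)) u
    ⟨a * f ^ s - f ^ s * v' * g ^ t, by linear_combination huv⟩
  refine Ideal.mem_span_pair.2 ⟨u', v', mul_right_cancel₀ (pow_ne_zero s (mul_ne_zero hf hg)) ?_⟩
  linear_combination huv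

end RegularPairs

/-! ### Parameters of normal graded domains are regular sequences -/

section Normal

variable {k A : Type*} [Field k] [CommRing A] [IsDomain A] [Algebra k A]
  {𝒜 : ℕ → Submodule k A} [GradedAlgebra 𝒜] [Module.Finite k (𝒜 0)]

/-- The degree zero part is a field, as a domain of finite dimension over `k`. -/
theorem isUnit_of_mem_zero {z : A} (hz : z ∈ 𝒜 0) (h0 : z ≠ 0) : IsUnit z := by
  have hmaps : ∀ x ∈ 𝒜 0, LinearMap.mulLeft k z x ∈ 𝒜 0 := fun x hx => by
    simpa using SetLike.mul_mem_graded hz hx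
  have hinj : Function.Injective ((LinearMap.mulLeft k z).restrict hmaps) := by
    intro x y hxy
    have := congrArg Subtype.val hxy
    exact Subtype.ext (mul_left_cancel₀ h0 (by simpa using this))
  obtain ⟨y, hy⟩ := LinearMap.injective_iff_surjective.1 hinj ⟨1, SetLike.GradedOne.one_mem⟩
  exact IsUnit.of_mul_eq_one (y : A) (by simpa using congrArg Subtype.val hy)

/-- In dimension greater than one, one homogeneous element does not suffice to generate the
irrelevant ideal up to radical. -/
theorem ne_zero_of_radical_eq [IsNoetherianRing A] (hdim : ¬ ringKrullDim A ≤ 1) {f g : A} {d : ℕ}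
    (hg : g ∈ 𝒜 d)
    (hrad : (Ideal.span {f, g}).radical = (HomogeneousIdeal.irrelevant 𝒜).toIdeal) : f ≠ 0 := by
  rintro rfl
  exact hdim (ringKrullDim_le_one_of_radical_eq 𝒜 hg (by rwa [Ideal.span_insert_zero] at hrad))

/-- Serre's condition `S₂` for a normal graded domain of dimension greater than one. If `w` is a
homogeneous fraction outside `A` with `𝔪 w ⊆ A`, then either `𝔪 w ⊆ 𝔪`, so that `w` is integral, or
`𝔪 w` contains a unit, so that `𝔪` is principal and `dim A ≤ 1`. -/
theorem isRegularModulo_of_radical_eq [IsNoetherianRing A] [IsIntegrallyClosed A]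
    (hdim : ¬ ringKrullDim A ≤ 1) {f g : A} {d d' : ℕ} (hf : f ∈ 𝒜 d) (hg : g ∈ 𝒜 d')
    (hrad : (Ideal.span {f, g}).radical = (HomogeneousIdeal.irrelevant 𝒜).toIdeal) :
    IsRegularModulo f g := by
  have hf0 : f ≠ 0 := ne_zero_of_radical_eq hdim hg hrad
  have hfirr : f ∈ (HomogeneousIdeal.irrelevant 𝒜).toIdeal :=
    hrad ▸ Ideal.le_radical (Ideal.subset_span (by simp))
  suffices H : ∀ n, ∀ b ∈ 𝒜 n, f ∣ g * b → f ∣ b by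
    rintro b ⟨c, hc⟩
    classical
    rw [← sum_support_decompose 𝒜 b]
    refine Finset.dvd_sum fun n _ => H n _ (SetLike.coe_mem _) ?_
    rw [← coe_decompose_mul_add_of_left_mem 𝒜 hg, hc]
    obtain ⟨w, -, hw⟩ := exists_decompose_mul hf c (d' + n)
    exact ⟨w, hw⟩
  intro n b hb hgb
  by_contra hfb
  obtain ⟨N, hN⟩ := exists_forall_ge_mem_of_radical_eq hrad
  -- a multiple of `b` of maximal degree outside `(f)`
  set S : Set ℕ := {m | ∃ c ∈ 𝒜 m, ¬ f ∣ c * b}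
  have hS : S.Nonempty := ⟨0, 1, SetLike.GradedOne.one_mem, by simpa using hfb⟩
  have hSb : BddAbove S := by
    refine ⟨N, fun m ⟨c, hc, hc'⟩ => ?_⟩
    by_contra hm
    obtain ⟨u, v, rfl⟩ := Ideal.mem_span_pair.1 (hN m (not_le.1 hm).le c hc)
    refine hc' ?_
    rw [add_mul, mul_assoc v]
    exact dvd_add ⟨u * b, by ring⟩ (hgb.mul_left _)
  obtain ⟨c, hc, hcb⟩ := Nat.sSup_mem hS hSb
  set b' := c * b
  have hb' : b' ∈ 𝒜 (sSup S + n) := SetLike.mul_mem_graded hc hb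
  have hdvd : ∀ j, 0 < j → ∀ y ∈ 𝒜 j, f ∣ y * b' := by
    intro j hj y hy
    by_contra h
    have := le_csSup hSb (show j + sSup S ∈ S from
      ⟨y * c, SetLike.mul_mem_graded hy hc, by rwa [mul_assoc]⟩)
    omega
  have ideal_induction : ∀ I : Ideal A, (∀ j, 0 < j → ∀ y ∈ 𝒜 j, y ∈ I) →
      (HomogeneousIdeal.irrelevant 𝒜).toIdeal ≤ I := by
    intro I hI
    rw [HomogeneousIdeal.irrelevant_eq_span, Ideal.span_le]
    intro y hy
    simp only [Set.mem_iUnion] at hy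
    obtain ⟨j, hj, hy⟩ := hy
    exact hI j hj y hy
  have hdvd' : ∀ y ∈ (HomogeneousIdeal.irrelevant 𝒜).toIdeal, f ∣ y * b' := by
    intro y hy
    have := ideal_induction (Submodule.comap (LinearMap.mulRight A b') (Ideal.span {f}))
      (fun j hj y hy => by simpa [Ideal.mem_span_singleton] using hdvd j hj y hy) hy
    simpa [Ideal.mem_span_singleton] using this
  by_cases hcase : ∀ j, 0 < j → ∀ y ∈ 𝒜 j, ∀ z, y * b' = f * z →
      z ∈ (HomogeneousIdeal.irrelevant 𝒜).toIdeal
  · -- the fraction `b' / f` is integral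
    let F := FractionRing A
    have hint : IsIntegral A (algebraMap A F b' / algebraMap A F f) := by
      have hf0' : algebraMap A F f ≠ 0 := by simpa using hf0
      refine isIntegral_of_smul_mem_submodule (M := F)
        (Submodule.map (Algebra.linearMap A F) (HomogeneousIdeal.irrelevant 𝒜).toIdeal) ?_
        ((IsNoetherian.noetherian (R := A) (M := A) _).map _) _ ?_
      · intro h
        have := (Submodule.eq_bot_iff _).1 h _ (Submodule.mem_map_of_mem hfirr)
        exact hf0' this
      · rintro _ ⟨y, hy, rfl⟩
        have h1 : y ∈ Submodule.comap (LinearMap.mulRight A b')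
            (Submodule.map (LinearMap.mulLeft A f) (HomogeneousIdeal.irrelevant 𝒜).toIdeal) := by
          refine ideal_induction _ (fun j hj y hy => ?_) hy
          obtain ⟨z, hz⟩ := hdvd j hj y hy
          exact ⟨z, hcase j hj y hy z hz, by simpa using hz.symm⟩
        obtain ⟨z, hz, hz'⟩ := h1
        refine ⟨z, hz, ?_⟩
        have : algebraMap A F f * algebraMap A F z = algebraMap A F y * algebraMap A F b' := by
          rw [← map_mul, ← map_mul]
          exact congrArg _ (by simpa using hz')
        simp only [Algebra.linearMap_apply, smul_eq_mul]
        rw [div_mul_eq_mul_div, eq_div_iff hf0']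
        linear_combination this
    obtain ⟨w, hw⟩ := IsIntegrallyClosed.isIntegral_iff.1 hint
    refine hcb ⟨w, ?_⟩
    have hf0' : algebraMap A F f ≠ 0 := by simpa using hf0
    rw [eq_div_iff hf0', ← map_mul] at hw
    rw [mul_comm f, IsFractionRing.injective A F hw]
  · -- some `y b'` equals a unit times `f`, and then `y` generates the irrelevant ideal
    push Not at hcase
    obtain ⟨j, hj, y, hy, z, hz, hzirr⟩ := hcase
    have hz0 : z ∈ 𝒜 0 := by
      obtain ⟨w, hw, hw'⟩ := exists_decompose_mul hf z (j + (sSup S + n))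
      rw [← hz, decompose_of_mem_same 𝒜 (SetLike.mul_mem_graded hy hb'), hz] at hw'
      rw [← mul_left_cancel₀ hf0 hw'] at hw
      rcases mem_intPart_cases hw with h | ⟨i, -, hi⟩
      · exact absurd (h ▸ zero_mem _) hzirr
      · rcases Nat.eq_zero_or_pos i with rfl | hi0
        · exact hi
        · exact absurd (mem_irrelevant_of_mem_pos hi0 hi) hzirr
    have hzu : IsUnit z := isUnit_of_mem_zero hz0 fun h => hzirr (h ▸ zero_mem _)
    refine hdim (ringKrullDim_le_one_of_radical_eq 𝒜 hy ?_)
    have : Ideal.span {y} = (HomogeneousIdeal.irrelevant 𝒜).toIdeal := by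
      refine le_antisymm
        ((Ideal.span_singleton_le_iff_mem _).2 (mem_irrelevant_of_mem_pos hj hy)) ?_
      intro x hx
      obtain ⟨e, he⟩ := hdvd' x hx
      have : x * z = y * e := mul_left_cancel₀ hf0 (by linear_combination y * he - x * hz)
      rw [Ideal.mem_span_singleton, ← hzu.dvd_mul_right (b := x), this]
      exact dvd_mul_right _ _
    rw [this, irrelevant_isPrime.radical]

end Normal

/-! ### The top degree of the quotient by a system of parameters -/

section TopDegree

variable {k A : Type*} [Field k] [CommRing A] [Algebra k A]

/-- `TopNonzero 𝒜 f g Δ j` says that the degree `j` part of `A_{fg} / (A_f + A_g)` is nonzero, where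
`Δ = deg f + deg g`: some fraction `a / (f g) ^ t` of degree `j` has `a ∉ (f ^ t, g ^ t)`. -/
def TopNonzero (𝒜 : ℕ → Submodule k A) (f g : A) (Δ : ℕ) (j : ℤ) : Prop :=
  ∃ t : ℕ, ∃ a ∈ intPart 𝒜 (j + t * Δ), a ∉ Ideal.span {f ^ t, g ^ t}

/-- `n` is the largest degree of a nonzero homogeneous element of `A / (f, g)`. -/
def IsTopDegree (𝒜 : ℕ → Submodule k A) (f g : A) (n : ℕ) : Prop :=
  IsGreatest {n | ∃ a ∈ 𝒜 n, a ∉ Ideal.span {f, g}} n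

variable {𝒜 : ℕ → Submodule k A} [GradedAlgebra 𝒜] {f g : A} {d d' : ℕ}

theorem exists_isTopDegree [IsNoetherianRing A] [IsDomain A]
    (hrad : (Ideal.span {f, g}).radical = (HomogeneousIdeal.irrelevant 𝒜).toIdeal) :
    ∃ n, IsTopDegree 𝒜 f g n := by
  obtain ⟨N, hN⟩ := exists_forall_ge_mem_of_radical_eq hrad
  have hne : {n | ∃ a ∈ 𝒜 n, a ∉ Ideal.span {f, g}}.Nonempty := by
    refine ⟨0, 1, SetLike.GradedOne.one_mem, fun h => ?_⟩
    have h1 := Ideal.le_radical h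
    rw [hrad] at h1
    exact irrelevant_isPrime.ne_top ((Ideal.eq_top_iff_one _).2 h1)
  have hbdd : BddAbove {n | ∃ a ∈ 𝒜 n, a ∉ Ideal.span {f, g}} :=
    ⟨N, fun n ⟨a, ha, h⟩ => by by_contra hn; exact h (hN n (not_le.1 hn).le a ha)⟩
  exact ⟨_, Nat.sSup_mem hne hbdd, fun n hn => le_csSup hbdd hn⟩

/-- Two-generator form of `exists_homogeneous_coeff`. -/
theorem exists_homogeneous_coeff_pair (hf : f ∈ 𝒜 d) (hg : g ∈ 𝒜 d') {n : ℤ} {a : A}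
    (ha : a ∈ intPart 𝒜 n) (hmem : a ∈ Ideal.span {f, g}) :
    ∃ u ∈ intPart 𝒜 (n - d), ∃ v ∈ intPart 𝒜 (n - d'), a = f * u + g * v := by
  obtain ⟨u, hu, rfl⟩ := exists_homogeneous_coeff (f := ![f, g]) (d := ![d, d'])
    (by intro i; fin_cases i <;> simpa) ha (by simpa [Matrix.range_cons, Set.pair_comm] using hmem)
  exact ⟨u 0, by simpa using hu 0, u 1, by simpa using hu 1, by simp [Fin.sum_univ_two]⟩

/-- If `N` is the top degree of `A / (f, g)`, the top degree of `A / (f ^ (s + 1), g ^ (t + 1))` is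
at most `N + s deg f + t deg g`. -/
theorem mem_span_pow_of_isTopDegree (hf : f ∈ 𝒜 d) (hg : g ∈ 𝒜 d') {N : ℕ}
    (hN : IsTopDegree 𝒜 f g N) (m : ℕ) : ∀ s t : ℕ, s + t = m → ∀ n : ℤ, N + s * d + t * d' < n →
      ∀ a ∈ intPart 𝒜 n, a ∈ Ideal.span {f ^ (s + 1), g ^ (t + 1)} := by
  induction m with
  | zero =>
    rintro s t hst n hn a ha
    obtain ⟨rfl, rfl⟩ : s = 0 ∧ t = 0 := by omega
    rcases mem_intPart_cases ha with rfl | ⟨i, rfl, ha⟩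
    · exact zero_mem _
    · by_contra h
      have := hN.2 ⟨a, ha, by simpa using h⟩
      omega
  | succ m ih =>
    rintro s t hst n hn a ha
    have h1 : a ∈ Ideal.span {f, g} := by
      rcases mem_intPart_cases ha with rfl | ⟨i, rfl, ha⟩
      · exact zero_mem _
      · by_contra h
        have := hN.2 ⟨a, ha, by simpa using h⟩
        have : (0 : ℤ) ≤ s * d + t * d' := by positivity
        omega
    obtain ⟨u, hu, v, hv, rfl⟩ := exists_homogeneous_coeff_pair hf hg ha h1
    refine add_mem ?_ ?_
    · cases s with
      | zero => exact Ideal.mul_mem_right _ _ (Ideal.subset_span (by simp))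
      | succ s =>
        obtain ⟨x, y, rfl⟩ := Ideal.mem_span_pair.1
          (ih s t (by omega) (n - d) (by push_cast at hn; linarith) u hu)
        exact Ideal.mem_span_pair.2 ⟨x, f * y, by ring⟩
    · cases t with
      | zero => exact Ideal.mul_mem_right _ _ (Ideal.subset_span (by simp))
      | succ t =>
        obtain ⟨x, y, rfl⟩ := Ideal.mem_span_pair.1
          (ih s t (by omega) (n - d') (by push_cast at hn; linarith) v hv)
        exact Ideal.mem_span_pair.2 ⟨g * x, y, by ring⟩

theorem IsTopDegree.isGreatest_topNonzero (hf : f ∈ 𝒜 d) (hg : g ∈ 𝒜 d') {N : ℕ}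
    (hN : IsTopDegree 𝒜 f g N) :
    IsGreatest {j | TopNonzero 𝒜 f g (d + d') j} ((N : ℤ) - d - d') := by
  constructor
  · obtain ⟨a, ha, h⟩ := hN.1
    exact ⟨1, a, mem_intPart_of_eq (by push_cast; ring) ha, by simpa using h⟩
  · rintro j ⟨t, a, ha, h⟩
    by_contra hj
    push Not at hj
    refine h ?_
    cases t with
    | zero => simp
    | succ t =>
      refine mem_span_pow_of_isTopDegree hf hg hN _ t t rfl _ ?_ a ha
      push_cast
      linarith

section Independence

variable (𝒜)

/-- The Hilbert function of a graded algebra, extended by zero to negative degrees. -/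
noncomputable def hilbertFun (n : ℤ) : ℤ := Module.finrank k (intPart 𝒜 n)

variable {𝒜}

theorem finite_intPart [IsNoetherianRing A] [Module.Finite k (𝒜 0)] (n : ℤ) :
    Module.Finite k (intPart 𝒜 n) := by
  rcases lt_or_ge n 0 with h | h
  · rw [intPart_of_neg 𝒜 h]
    infer_instance
  · lift n to ℕ using h
    rw [intPart_natCast]
    exact finite_component 𝒜 n

theorem finrank_map_mulLeft [IsDomain A] {x : A} (hx : x ≠ 0) (V : Submodule k A) :
    Module.finrank k (V.map (LinearMap.mulLeft k x)) = Module.finrank k V :=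
  (Submodule.equivMapOfInjective _ (mul_right_injective₀ hx) V).finrank_eq.symm

/-- The Koszul resolution of `A / (f, g)` in degree `n`: the alternating sum of Hilbert functions
equals `dim (A / (f, g))_n`. -/
theorem hilbertFun_koszul [IsNoetherianRing A] [IsDomain A] [Module.Finite k (𝒜 0)]
    (hf : f ∈ 𝒜 d) (hg : g ∈ 𝒜 d') (hf0 : f ≠ 0) (hg0 : g ≠ 0) (h : IsRegularModulo f g) (n : ℤ) :
    hilbertFun 𝒜 n - hilbertFun 𝒜 (n - d) - hilbertFun 𝒜 (n - d') + hilbertFun 𝒜 (n - d - d') =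
      hilbertFun 𝒜 n - Module.finrank k ↥((intPart 𝒜 (n - d)).map (LinearMap.mulLeft k f) ⊔
        (intPart 𝒜 (n - d')).map (LinearMap.mulLeft k g)) := by
  have hfin : ∀ n, Module.Finite k (intPart 𝒜 n) := finite_intPart
  -- the only syzygies are the Koszul ones, because `f, g` is a regular sequence
  have hinf : (intPart 𝒜 (n - d)).map (LinearMap.mulLeft k f) ⊓
        (intPart 𝒜 (n - d')).map (LinearMap.mulLeft k g) =
      (intPart 𝒜 (n - d - d')).map (LinearMap.mulLeft k (f * g)) := by
    apply le_antisymm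
    · rintro _ ⟨⟨u, hu, rfl⟩, ⟨v, hv, hv'⟩⟩
      simp only [LinearMap.mulLeft_apply] at hv'
      obtain ⟨c, rfl⟩ := h v ⟨u, hv'⟩
      have hu' : u = g * c := mul_left_cancel₀ hf0 (by rw [← hv']; ring)
      obtain ⟨w, hw, hw'⟩ : ∃ w ∈ intPart 𝒜 (n - d - d'), u = g * w := by
        rcases mem_intPart_cases hu with h0 | ⟨m, hm, hu⟩
        · exact ⟨0, zero_mem _, by simp [h0]⟩
        · obtain ⟨w, hw, hw'⟩ := exists_decompose_mul hg c m
          rw [← hu', decompose_of_mem_same 𝒜 hu, hm] at *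
          exact ⟨w, hw, hw'⟩
      exact ⟨w, hw, by simp [hw']⟩
    · rintro _ ⟨w, hw, rfl⟩
      refine ⟨⟨g * w, mul_mem_intPart hg hw (by ring), by simp⟩,
        ⟨f * w, mul_mem_intPart hf hw (by ring), by simp; ring⟩⟩
  have := Submodule.finrank_sup_add_finrank_inf_eq
    ((intPart 𝒜 (n - d)).map (LinearMap.mulLeft k f))
    ((intPart 𝒜 (n - d')).map (LinearMap.mulLeft k g))
  rw [hinf, finrank_map_mulLeft hf0, finrank_map_mulLeft hg0,
    finrank_map_mulLeft (mul_ne_zero hf0 hg0)] at this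
  unfold hilbertFun
  omega

/-- The Koszul alternating sum in degree `n` vanishes exactly when `A / (f, g)` does. -/
theorem hilbertFun_koszul_eq_zero_iff [IsNoetherianRing A] [IsDomain A] [Module.Finite k (𝒜 0)]
    (hf : f ∈ 𝒜 d) (hg : g ∈ 𝒜 d') (hf0 : f ≠ 0) (hg0 : g ≠ 0) (h : IsRegularModulo f g) (n : ℤ) :
    hilbertFun 𝒜 n - hilbertFun 𝒜 (n - d) - hilbertFun 𝒜 (n - d') + hilbertFun 𝒜 (n - d - d') = 0 ↔
      ∀ a ∈ intPart 𝒜 n, a ∈ Ideal.span {f, g} := by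
  have hfin : ∀ n, Module.Finite k (intPart 𝒜 n) := finite_intPart
  rw [hilbertFun_koszul hf hg hf0 hg0 h]
  set W := (intPart 𝒜 (n - d)).map (LinearMap.mulLeft k f) ⊔
        (intPart 𝒜 (n - d')).map (LinearMap.mulLeft k g) with hW
  have hWle : W ≤ intPart 𝒜 n := by
    refine sup_le ?_ ?_
    · rintro _ ⟨u, hu, rfl⟩
      exact mul_mem_intPart hf hu (by ring)
    · rintro _ ⟨u, hu, rfl⟩
      exact mul_mem_intPart hg hu (by ring)
  have hWspan : ∀ a ∈ W, a ∈ Ideal.span {f, g} := by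
    intro a ha
    obtain ⟨_, ⟨u, -, rfl⟩, _, ⟨v, -, rfl⟩, rfl⟩ := Submodule.mem_sup.1 ha
    exact Ideal.mem_span_pair.2 ⟨u, v, by simp [mul_comm]⟩
  have hrank : hilbertFun 𝒜 n - Module.finrank k W = 0 ↔ W = intPart 𝒜 n := by
    constructor
    · intro h0
      exact Submodule.eq_of_le_of_finrank_eq hWle (by unfold hilbertFun at h0; omega)
    · intro h0
      rw [h0]
      simp [hilbertFun]
  rw [hrank]
  constructor
  · intro h0 a ha
    exact hWspan a (h0 ▸ ha)
  · intro h0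
    refine le_antisymm hWle fun a ha => ?_
    obtain ⟨u, hu, v, hv, rfl⟩ := exists_homogeneous_coeff_pair hf hg ha (h0 a ha)
    exact add_mem (Submodule.mem_sup_left ⟨u, hu, rfl⟩) (Submodule.mem_sup_right ⟨v, hv, rfl⟩)

/-- The number `N - deg f - deg g`, with `N` the top degree of `A / (f, g)`, does not depend on the
parameters: it is the degree of the Hilbert series as a rational function. -/
theorem IsTopDegree.le_of_isTopDegree [IsNoetherianRing A] [IsDomain A] [Module.Finite k (𝒜 0)]
    (hf : f ∈ 𝒜 d) (hg : g ∈ 𝒜 d') (hf0 : f ≠ 0) (hg0 : g ≠ 0) (h : IsRegularModulo f g)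
    {f₁ g₁ : A} {e e' : ℕ}
    (hf₁ : f₁ ∈ 𝒜 e) (hg₁ : g₁ ∈ 𝒜 e') (hf₁0 : f₁ ≠ 0) (hg₁0 : g₁ ≠ 0) (h₁ : IsRegularModulo f₁ g₁)
    {N M : ℕ} (hN : IsTopDegree 𝒜 f g N) (hM : IsTopDegree 𝒜 f₁ g₁ M) (he : 0 < e) (he' : 0 < e') :
    N + e + e' ≤ M + d + d' := by
  by_contra! hlt
  have hc := hilbertFun_koszul_eq_zero_iff hf hg hf0 hg0 h
  have hc₁ := hilbertFun_koszul_eq_zero_iff hf₁ hg₁ hf₁0 hg₁0 h₁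
  have hzero : ∀ n : ℤ, N < n → ∀ a ∈ intPart 𝒜 n, a ∈ Ideal.span {f, g} := by
    intro n hn a ha
    rcases mem_intPart_cases ha with rfl | ⟨i, rfl, ha⟩
    · exact zero_mem _
    · by_contra h0
      have := hN.2 ⟨a, ha, h0⟩
      omega
  have hzero₁ : ∀ n : ℤ, M < n → ∀ a ∈ intPart 𝒜 n, a ∈ Ideal.span {f₁, g₁} := by
    intro n hn a ha
    rcases mem_intPart_cases ha with rfl | ⟨i, rfl, ha⟩
    · exact zero_mem _
    · by_contra h0
      have := hM.2 ⟨a, ha, h0⟩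
      omega
  have hne : ¬ ∀ a ∈ intPart 𝒜 (N : ℤ), a ∈ Ideal.span {f, g} := by
    obtain ⟨a, ha, h0⟩ := hN.1
    exact fun H => h0 (H a (by rwa [intPart_natCast]))
  rw [← hc] at hne
  -- both second differences of the Koszul sums agree; evaluate them in degree `N + e + e'`
  set n : ℤ := (N : ℤ) + e + e' with hn
  have e1 := (hc n).2 (hzero n (by omega))
  have e2 := (hc (n - e)).2 (hzero _ (by omega))
  have e3 := (hc (n - e')).2 (hzero _ (by omega))
  have m1 := (hc₁ n).2 (hzero₁ n (by omega))
  have m2 := (hc₁ (n - d)).2 (hzero₁ _ (by omega))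
  have m3 := (hc₁ (n - d')).2 (hzero₁ _ (by omega))
  have m4 := (hc₁ (n - d - d')).2 (hzero₁ _ (by omega))
  apply hne
  have r1 : (N : ℤ) = n - e - e' := by omega
  rw [r1]
  simp only [sub_right_comm _ (e : ℤ) (d : ℤ), sub_right_comm _ (e : ℤ) (d' : ℤ),
    sub_right_comm _ (e' : ℤ) (d : ℤ), sub_right_comm _ (e' : ℤ) (d' : ℤ)] at *
  linarith

end Independence

end TopDegree

/-! ### Top Čech cohomology -/

section Cech

open GradedCech

variable {k A : Type*} [Field k] [CommRing A] [Algebra k A]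

theorem faceMap_mk_mul {n : ℕ} (f : Fin n → A) (i : Fin n) (u : A)
    (y : Submonoid.powers (∏ l ∈ Finset.univ.erase i, f l)) :
    faceMap f i (Localization.mk u y) * algebraMap A (Localization.Away (∏ l, f l)) y =
      algebraMap A _ u := by
  rw [← (faceMap f i).commutes (y : A), ← map_mul, Localization.mk_eq_mk',
    IsLocalization.mk'_spec, AlgHom.commutes]

/-- Boundaries have the form `(u f₀ ^ s + v f₁ ^ s) / (f₀ f₁) ^ s`. -/
theorem exists_mul_pow_eq_of_mem_boundary {f : Fin 2 → A} {x : Localization.Away (∏ l, f l)}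
    (hx : x ∈ boundary f) : ∃ (s : ℕ) (u v : A),
      x * algebraMap A _ (f 0 * f 1) ^ s = algebraMap A _ (u * f 0 ^ s + v * f 1 ^ s) := by
  have he0 : (∏ l ∈ Finset.univ.erase (0 : Fin 2), f l) = f 1 := by
    rw [show Finset.univ.erase (0 : Fin 2) = {1} from rfl, Finset.prod_singleton]
  have he1 : (∏ l ∈ Finset.univ.erase (1 : Fin 2), f l) = f 0 := by
    rw [show Finset.univ.erase (1 : Fin 2) = {0} from rfl, Finset.prod_singleton]
  induction hx using Submodule.iSup_induction' with
  | zero => exact ⟨0, 0, 0, by simp⟩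
  | add x y _ _ hx hy =>
    obtain ⟨s, u, v, h⟩ := hx
    obtain ⟨s', u', v', h'⟩ := hy
    refine ⟨s + s', u * f 1 ^ s' + u' * f 1 ^ s, v * f 0 ^ s' + v' * f 0 ^ s, ?_⟩
    simp only [map_add, map_mul, map_pow] at h h' ⊢
    linear_combination (algebraMap A _ (f 0) * algebraMap A _ (f 1)) ^ s' * h +
      (algebraMap A _ (f 0) * algebraMap A _ (f 1)) ^ s * h'
  | mem i x hx =>
    obtain ⟨y, rfl⟩ := hx
    induction y using Localization.induction_on with
    | H y =>
    obtain ⟨a, b, n, hn⟩ := y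
    have h := faceMap_mk_mul f i a ⟨b, n, hn⟩
    simp only at hn
    simp only [AlgHom.toLinearMap_apply]
    subst hn
    fin_cases i
    · refine ⟨n, a, 0, ?_⟩
      simp only [Fin.zero_eta, he0, map_add, map_mul, map_zero, map_pow, mul_pow] at h ⊢
      linear_combination algebraMap A _ (f 0) ^ n * h
    · refine ⟨n, 0, a, ?_⟩
      simp only [Fin.mk_one, he1, map_add, map_mul, map_zero, map_pow, mul_pow] at h ⊢
      linear_combination algebraMap A _ (f 1) ^ n * h

/-- A fraction `a / (f₀ f₁) ^ t` is a boundary of the Čech complex exactly when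
`a ∈ (f₀ ^ t, f₁ ^ t)`, provided that `f₀, f₁` is a regular sequence. -/
theorem mk_mem_boundary_iff [IsDomain A] {f : Fin 2 → A} (h0 : f 0 ≠ 0) (h1 : f 1 ≠ 0)
    (h : IsRegularModulo (f 0) (f 1)) (a : A) (t : ℕ) :
    (Localization.mk a (⟨(∏ l, f l) ^ t, t, rfl⟩ : Submonoid.powers (∏ l, f l))) ∈ boundary f ↔
      a ∈ Ideal.span {f 0 ^ t, f 1 ^ t} := by
  have hprod : ∏ l, f l = f 0 * f 1 := Fin.prod_univ_two f
  have hspec : Localization.mk a (⟨(∏ l, f l) ^ t, t, rfl⟩ : Submonoid.powers (∏ l, f l)) *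
      algebraMap A (Localization.Away (∏ l, f l)) (f 0 * f 1) ^ t = algebraMap A _ a := by
    rw [← map_pow, ← hprod, Localization.mk_eq_mk']
    exact IsLocalization.mk'_spec (Localization.Away (∏ l, f l)) a
      (⟨(∏ l, f l) ^ t, t, rfl⟩ : Submonoid.powers (∏ l, f l))
  constructor
  · intro hmem
    obtain ⟨s, u, v, huv⟩ := exists_mul_pow_eq_of_mem_boundary hmem
    have hne : ∏ l, f l ≠ 0 := hprod ▸ mul_ne_zero h0 h1
    have hinj : Function.Injective (algebraMap A (Localization.Away (∏ l, f l))) :=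
      IsLocalization.injective _ (powers_le_nonZeroDivisors_of_noZeroDivisors hne)
    have key : a * (f 0 * f 1) ^ s = (u * f 0 ^ s + v * f 1 ^ s) * (f 0 * f 1) ^ t := by
      apply hinj
      rw [map_mul _ a, map_mul _ _ (_ ^ t), ← huv, ← hspec, map_pow, map_pow]
      ring
    refine h.mem_span_of_mul_mem (s := s) h0 h1 ?_
    rw [key]
    exact Ideal.mem_span_pair.2 ⟨u * f 1 ^ t, v * f 0 ^ t, by ring⟩
  · intro hmem
    obtain ⟨u, v, rfl⟩ := Ideal.mem_span_pair.1 hmem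
    have hu := faceMap_mk_mul f 0 u ⟨(∏ l ∈ Finset.univ.erase 0, f l) ^ t, t, rfl⟩
    have hv := faceMap_mk_mul f 1 v ⟨(∏ l ∈ Finset.univ.erase 1, f l) ^ t, t, rfl⟩
    set U := faceMap f 0 (Localization.mk u ⟨(∏ l ∈ Finset.univ.erase 0, f l) ^ t, t, rfl⟩)
    set V := faceMap f 1 (Localization.mk v ⟨(∏ l ∈ Finset.univ.erase 1, f l) ^ t, t, rfl⟩)
    have hU : U ∈ boundary f := Submodule.mem_iSup_of_mem 0 ⟨_, rfl⟩
    have hV : V ∈ boundary f := Submodule.mem_iSup_of_mem 1 ⟨_, rfl⟩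
    have hunit : IsUnit (algebraMap A (Localization.Away (∏ l, f l)) (f 0 * f 1) ^ t) := by
      rw [← hprod]
      exact (IsLocalization.Away.algebraMap_isUnit _).pow t
    convert! add_mem hU hV using 1
    apply hunit.mul_right_cancel
    rw [hspec]
    simp only [show Finset.univ.erase (0 : Fin 2) = {1} from rfl,
      show Finset.univ.erase (1 : Fin 2) = {0} from rfl, Finset.prod_singleton, map_pow] at hu hv
    simp only [map_add, map_mul, map_pow, mul_pow]
    linear_combination -algebraMap A _ (f 0) ^ t * hu - algebraMap A _ (f 1) ^ t * hv

theorem topComponent_ne_bot_iff [IsDomain A] (𝒜 : ℕ → Submodule k A) {f : Fin 2 → A}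
    (δ : Fin 2 → ℕ) (h0 : f 0 ≠ 0) (h1 : f 1 ≠ 0) (h : IsRegularModulo (f 0) (f 1)) (j : ℤ) :
    topComponent 𝒜 f δ j ≠ ⊥ ↔ TopNonzero 𝒜 (f 0) (f 1) (δ 0 + δ 1) j := by
  have hsum : ∑ l, δ l = δ 0 + δ 1 := Fin.sum_univ_two δ
  rw [← not_iff_not, not_not, topComponent, awayComponent, AddMonoidHom.map_closure,
    AddSubgroup.closure_eq_bot_iff]
  constructor
  · rintro hsub ⟨t, a, ha, hna⟩
    rcases mem_intPart_cases ha with rfl | ⟨i, hi, ha⟩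
    · exact hna (zero_mem _)
    · refine hna ((mk_mem_boundary_iff h0 h1 h a t).1 ?_)
      rw [← Submodule.Quotient.mk_eq_zero]
      exact hsub ⟨_, ⟨t, i, a, ha, by rw [hi, hsum], rfl⟩, rfl⟩
  · rintro hnot _ ⟨_, ⟨t, i, a, ha, hi, rfl⟩, rfl⟩
    refine (Submodule.Quotient.mk_eq_zero _).2 ((mk_mem_boundary_iff h0 h1 h a t).2 ?_)
    by_contra hna
    exact hnot ⟨t, a, mem_intPart_of_eq (by rw [hi, hsum]) ha, hna⟩

end Cech

/-! ### The `a`-invariant -/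

section AInvariant

open GradedCech

variable {k A : Type*} [Field k] [CommRing A] [IsDomain A] [IsNoetherianRing A]
  [IsIntegrallyClosed A] [Algebra k A] {𝒜 : ℕ → Submodule k A} [GradedAlgebra 𝒜]
  [Module.Finite k (𝒜 0)]

omit [IsDomain A] [IsNoetherianRing A] [IsIntegrallyClosed A] [Module.Finite k (𝒜 0)] in
theorem degree_pos_of_mem_irrelevant {f : A} {d : ℕ} (hf : f ∈ 𝒜 d) (h0 : f ≠ 0)
    (h : f ∈ (HomogeneousIdeal.irrelevant 𝒜).toIdeal) : 0 < d :=
  Nat.pos_of_ne_zero fun hd => h0 (eq_zero_of_mem_irrelevant (hd ▸ hf) h)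

/-- The `a`-invariant of a normal graded domain of dimension two in terms of one homogeneous system
of parameters `f, g`: it is `N - deg f - deg g`, with `N` the top degree of `A / (f, g)`. -/
theorem isAInvariant_of_isTopDegree (hdim : ringKrullDim A = 2) {f g : A} {d d' : ℕ}
    (hf : f ∈ 𝒜 d) (hg : g ∈ 𝒜 d')
    (hrad : (Ideal.span {f, g}).radical = (HomogeneousIdeal.irrelevant 𝒜).toIdeal)
    {N : ℕ} (hN : IsTopDegree 𝒜 f g N) : IsAInvariant 𝒜 ((N : ℤ) - d - d') := by
  have hdim' : ¬ ringKrullDim A ≤ 1 := by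
    rw [hdim]
    decide
  refine ⟨⟨2, ![f, g], ![d, d'], by simpa using hdim, ?_, ?_⟩, ?_⟩
  · intro i
    fin_cases i <;> simpa
  · simpa [Matrix.range_cons, Set.pair_comm] using hrad
  · rintro n F δ hF
    obtain rfl : n = 2 := by
      have := hF.dim_eq
      rw [hdim] at this
      exact_mod_cast this.symm
    have hFrad : (Ideal.span {F 0, F 1}).radical = (HomogeneousIdeal.irrelevant 𝒜).toIdeal := by
      rw [← hF.radical_eq]
      congr 2
      ext x
      simp [Fin.exists_fin_two, eq_comm]
    have pair : ∀ {x y : A}, (Ideal.span {x, y}).radical =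
        (HomogeneousIdeal.irrelevant 𝒜).toIdeal → ∀ {c c' : ℕ}, x ∈ 𝒜 c → y ∈ 𝒜 c' →
        x ≠ 0 ∧ y ≠ 0 ∧ 0 < c ∧ 0 < c' ∧ IsRegularModulo x y := by
      intro x y hxy c c' hx hy
      have hx0 := ne_zero_of_radical_eq hdim' hy hxy
      have hy0 := ne_zero_of_radical_eq hdim' hx (by rwa [Set.pair_comm])
      exact ⟨hx0, hy0,
        degree_pos_of_mem_irrelevant hx hx0 (hxy ▸ Ideal.le_radical (Ideal.subset_span (by simp))),
        degree_pos_of_mem_irrelevant hy hy0 (hxy ▸ Ideal.le_radical (Ideal.subset_span (by simp))),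
        isRegularModulo_of_radical_eq hdim' hx hy hxy⟩
    obtain ⟨hf0, hg0, hd, hd', hreg⟩ := pair hrad hf hg
    obtain ⟨hF0, hF1, hδ, hδ', hFreg⟩ := pair hFrad (hF.mem 0) (hF.mem 1)
    obtain ⟨M, hM⟩ := exists_isTopDegree hFrad
    have hNM : (N : ℤ) - d - d' = M - δ 0 - δ 1 := by
      have h1 := hN.le_of_isTopDegree hf hg hf0 hg0 hreg
        (hF.mem 0) (hF.mem 1) hF0 hF1 hFreg hM hδ hδ'
      have h2 := hM.le_of_isTopDegree (hF.mem 0) (hF.mem 1) hF0 hF1 hFreg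
        hf hg hf0 hg0 hreg hN hd hd'
      omega
    simp only [topComponent_ne_bot_iff 𝒜 δ hF0 hF1 hFreg, hNM]
    exact hM.isGreatest_topNonzero (hF.mem 0) (hF.mem 1)

end AInvariant

/-! ### Existence of homogeneous systems of parameters -/

section Parameters

variable {k A : Type*} [Field k] [CommRing A] [IsDomain A] [Algebra k A]
  {𝒜 : ℕ → Submodule k A} [GradedAlgebra 𝒜] [Module.Finite k (𝒜 0)]

theorem le_irrelevant_of_isHomogeneous {P : Ideal A} (hP : P.IsHomogeneous 𝒜) (hne : P ≠ ⊤) :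
    P ≤ (HomogeneousIdeal.irrelevant 𝒜).toIdeal := by
  intro a ha
  change a ∈ HomogeneousIdeal.irrelevant 𝒜
  rw [HomogeneousIdeal.mem_irrelevant_iff, GradedRing.proj_apply]
  by_contra h0
  exact hne (Ideal.eq_top_of_isUnit_mem _ (hP 0 ha) (isUnit_of_mem_zero (SetLike.coe_mem _) h0))

omit [IsDomain A] [Module.Finite k (𝒜 0)] in
/-- The homogeneous core of a prime is prime, so minimal primes of homogeneous ideals coincide with
their core. -/
theorem isHomogeneous_of_mem_minimalPrimes {I P : Ideal A} (hI : I.IsHomogeneous 𝒜)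
    (hP : P ∈ I.minimalPrimes) : P.IsHomogeneous 𝒜 := by
  have hprime : P.IsPrime := hP.1.1
  have hle : I ≤ (P.homogeneousCore 𝒜).toIdeal := by
    rw [← hI.toIdeal_homogeneousCore_eq_self]
    exact Ideal.homogeneousCore_mono 𝒜 hP.1.2
  have := hP.2 ⟨hprime.homogeneousCore, hle⟩ (Ideal.toIdeal_homogeneousCore_le 𝒜 P)
  exact (Ideal.IsHomogeneous.iff_eq 𝒜 P).2 (le_antisymm (Ideal.toIdeal_homogeneousCore_le 𝒜 P) this)

omit [IsDomain A] [Module.Finite k (𝒜 0)] in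
/-- Homogeneous prime avoidance for finitely many pairwise incomparable homogeneous primes not
containing the irrelevant ideal. -/
theorem exists_homogeneous_forall_notMem (T : Finset (Ideal A)) (hprime : ∀ P ∈ T, P.IsPrime)
    (hhom : ∀ P ∈ T, P.IsHomogeneous 𝒜)
    (hirr : ∀ P ∈ T, ¬ (HomogeneousIdeal.irrelevant 𝒜).toIdeal ≤ P)
    (hinc : ∀ P ∈ T, ∀ Q ∈ T, Q ≤ P → Q = P) :
    ∃ (D : ℕ) (g : A), 0 < D ∧ g ∈ 𝒜 D ∧ ∀ P ∈ T, g ∉ P := by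
  classical
  -- for each `P` a homogeneous element outside `P` which lies in all other members of `T`; powers
  -- of these of a common degree are then added up
  have hex : ∀ P : T, ∃ (n : ℕ) (g : A), 0 < n ∧ g ∈ 𝒜 n ∧ g ∉ P.1 ∧ ∀ Q ∈ T, Q ≠ P.1 → g ∈ Q := by
    rintro ⟨P, hP⟩
    have hPp := hprime P hP
    have hnle : ¬ ((HomogeneousIdeal.irrelevant 𝒜).toIdeal ⊓ (T.erase P).inf id) ≤ P := by
      rw [hPp.inf_le, hPp.inf_le']
      rintro (h | ⟨Q, hQ, h⟩)
      · exact hirr P hP h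
      · rw [Finset.mem_erase] at hQ
        exact hQ.1 (hinc P hP Q hQ.2 h)
    obtain ⟨a, ha, haP⟩ := Set.not_subset.1 hnle
    obtain ⟨n, hn⟩ : ∃ n, (decompose 𝒜 a n : A) ∉ P := by
      by_contra! h
      refine haP ?_
      rw [← sum_support_decompose 𝒜 a]
      exact sum_mem fun n _ => h n
    refine ⟨n, decompose 𝒜 a n, ?_, SetLike.coe_mem _, hn, fun Q hQ hne => hhom Q hQ n ?_⟩
    · refine Nat.pos_of_ne_zero fun h0 => hn ?_
      subst h0
      rw [eq_zero_of_mem_irrelevant (SetLike.coe_mem (decompose 𝒜 a 0))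
        ((HomogeneousIdeal.irrelevant 𝒜).isHomogeneous 0 ha.1)]
      exact zero_mem _
    · exact (Finset.inf_le (f := id) (Finset.mem_erase.2 ⟨hne, hQ⟩) : _ ≤ Q) ha.2
  choose n g hn hg hgP hgQ using hex
  have hpow : ∀ P : T, g P ^ ((∏ Q, n Q) / n P) ∈ 𝒜 (∏ Q, n Q) := by
    intro P
    have := SetLike.pow_mem_graded ((∏ Q, n Q) / n P) (hg P)
    rwa [smul_eq_mul, Nat.div_mul_cancel (Finset.dvd_prod_of_mem n (Finset.mem_univ P))] at this
  refine ⟨∏ Q, n Q, ∑ P, g P ^ ((∏ Q, n Q) / n P), Finset.prod_pos fun Q _ => hn Q,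
    sum_mem fun P _ => hpow P, ?_⟩
  intro P hP hmem
  have hPp := hprime P hP
  rw [← Finset.add_sum_erase _ _ (Finset.mem_univ (⟨P, hP⟩ : T))] at hmem
  refine hgP ⟨P, hP⟩ (hPp.mem_of_pow_mem _ ((Ideal.add_mem_iff_left _ ?_).1 hmem))
  refine sum_mem fun Q hQ => Ideal.pow_mem_of_mem _ (hgQ Q P hP ?_) _ ?_
  · rintro rfl
    exact (Finset.mem_erase.1 hQ).1 rfl
  · exact Nat.div_pos (Nat.le_of_dvd (Finset.prod_pos fun Q _ => hn Q)
      (Finset.dvd_prod_of_mem n (Finset.mem_univ Q))) (hn Q)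

/-- In dimension two, every nonzero homogeneous element of positive degree is part of a homogeneous
system of parameters. With `g` outside all minimal primes of `(x)`, a minimal prime of `(x, g)`
other than the irrelevant ideal would give a chain of primes of length three. -/
theorem exists_radical_eq_irrelevant [IsNoetherianRing A] (hdim : ringKrullDim A = 2) {x : A}
    {d : ℕ} (hd : 0 < d) (hx : x ∈ 𝒜 d) (hx0 : x ≠ 0) :
    ∃ (d' : ℕ) (g : A), g ∈ 𝒜 d' ∧
      (Ideal.span {x, g}).radical = (HomogeneousIdeal.irrelevant 𝒜).toIdeal := by
  have hdim' : ¬ ringKrullDim A ≤ 1 := by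
    rw [hdim]
    decide
  have hxirr := mem_irrelevant_of_mem_pos hd hx
  have hprimeIrr : (HomogeneousIdeal.irrelevant 𝒜).toIdeal.IsPrime := irrelevant_isPrime
  have hIhom : (Ideal.span {x}).IsHomogeneous 𝒜 :=
    Ideal.homogeneous_span 𝒜 _ fun y hy => ⟨d, by rwa [Set.mem_singleton_iff.1 hy]⟩
  have hfin := Ideal.finite_minimalPrimes_of_isNoetherianRing A (Ideal.span {x})
  have hirr : ∀ P ∈ (Ideal.span {x}).minimalPrimes,
      ¬ (HomogeneousIdeal.irrelevant 𝒜).toIdeal ≤ P := by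
    intro P hP hle
    refine hdim' (ringKrullDim_le_one_of_radical_eq 𝒜 hx (le_antisymm ?_ ?_))
    · exact hprimeIrr.radical_le_iff.2 ((Ideal.span_singleton_le_iff_mem _).2 hxirr)
    · rw [← Ideal.sInf_minimalPrimes]
      refine le_sInf fun Q hQ => ?_
      have hQle : Q ≤ P := (le_irrelevant_of_isHomogeneous
        (isHomogeneous_of_mem_minimalPrimes hIhom hQ) hQ.1.1.ne_top).trans hle
      exact hle.trans (hP.2 hQ.1 hQle)
  obtain ⟨D, g, hD, hg, hgP⟩ := exists_homogeneous_forall_notMem (𝒜 := 𝒜) hfin.toFinset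
    (fun P hP => ((hfin.mem_toFinset).1 hP).1.1)
    (fun P hP => isHomogeneous_of_mem_minimalPrimes hIhom ((hfin.mem_toFinset).1 hP))
    (fun P hP => hirr P ((hfin.mem_toFinset).1 hP))
    (fun P hP Q hQ h => le_antisymm h
      (((hfin.mem_toFinset).1 hP).2 ((hfin.mem_toFinset).1 hQ).1 h))
  refine ⟨D, g, hg, ?_⟩
  have hJhom : (Ideal.span {x, g}).IsHomogeneous 𝒜 :=
    Ideal.homogeneous_span 𝒜 _ (by
      rintro y (rfl | rfl)
      exacts [⟨d, hx⟩, ⟨D, hg⟩])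
  apply le_antisymm
  · refine hprimeIrr.radical_le_iff.2 (Ideal.span_le.2 ?_)
    rintro y (rfl | rfl)
    exacts [hxirr, mem_irrelevant_of_mem_pos hD hg]
  · rw [← Ideal.sInf_minimalPrimes]
    refine le_sInf fun Q hQ => ?_
    by_contra hle
    have hQp : Q.IsPrime := hQ.1.1
    have hQirr := le_irrelevant_of_isHomogeneous
      (isHomogeneous_of_mem_minimalPrimes hJhom hQ) hQp.ne_top
    obtain ⟨P, hP, hPQ⟩ := Ideal.exists_minimalPrimes_le (I := Ideal.span {x}) (J := Q)
      ((Ideal.span_mono (by simp)).trans hQ.1.2)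
    have hPp : P.IsPrime := hP.1.1
    have hgQ : g ∈ Q := hQ.1.2 (Ideal.subset_span (by simp))
    have hgP' : g ∉ P := hgP P ((hfin.mem_toFinset).2 hP)
    have hxP : x ∈ P := hP.1.2 (Ideal.mem_span_singleton_self x)
    let p : Fin 4 → PrimeSpectrum A :=
      ![⟨⊥, Ideal.isPrime_bot⟩, ⟨P, hPp⟩, ⟨Q, hQp⟩, ⟨_, hprimeIrr⟩]
    have hlt : ∀ i : Fin 3, p i.castSucc < p i.succ := by
      intro i
      fin_cases i
      · change (⊥ : Ideal A) < P
        exact bot_lt_iff_ne_bot.2 fun h => hx0 (by simpa [h] using hxP)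
      · change P < Q
        exact lt_of_le_of_ne hPQ fun h => hgP' (h ▸ hgQ)
      · change Q < (HomogeneousIdeal.irrelevant 𝒜).toIdeal
        exact lt_of_le_of_ne hQirr fun h => hle h.ge
    have hlen := Order.LTSeries.length_le_krullDim (⟨3, p, hlt⟩ : LTSeries (PrimeSpectrum A))
    rw [show Order.krullDim (PrimeSpectrum A) = 2 from hdim] at hlen
    change ((3 : ℕ) : WithBot ℕ∞) ≤ 2 at hlen
    exact absurd hlen (by decide)

end Parameters

/-! ### Top cohomology and multiplication by parameters -/

section Shift

variable {k A : Type*} [Field k] [CommRing A] [IsDomain A] [Algebra k A]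
  {𝒜 : ℕ → Submodule k A} [GradedAlgebra 𝒜]

/-- Multiplication by a linear parameter `x` is surjective on the top local cohomology, so
nonvanishing passes to lower degrees. -/
theorem TopNonzero.of_succ {x g : A} {d : ℕ} (hg : g ∈ 𝒜 d) (hx0 : x ≠ 0) (hg0 : g ≠ 0)
    (h : IsRegularModulo x g) {i : ℤ} (hi : TopNonzero 𝒜 x g (1 + d) (i + 1)) :
    TopNonzero 𝒜 x g (1 + d) i := by
  obtain ⟨t, a, ha, hna⟩ := hi
  -- `a / (x g) ^ t = x • (g a / (x g) ^ (t + 1))`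
  refine ⟨t + 1, g * a, mul_mem_intPart hg ha (by push_cast; ring), fun hmem => hna ?_⟩
  refine h.mem_span_of_mul_mem (s := 1) hx0 hg0 ?_
  rw [show a * (x * g) ^ 1 = x * (g * a) by ring]
  exact Ideal.mul_mem_left _ _ hmem

theorem TopNonzero.of_le {x g : A} {d : ℕ} (hg : g ∈ 𝒜 d) (hx0 : x ≠ 0) (hg0 : g ≠ 0)
    (h : IsRegularModulo x g) {i j : ℤ} (hij : i ≤ j) (hj : TopNonzero 𝒜 x g (1 + d) j) :
    TopNonzero 𝒜 x g (1 + d) i := by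
  obtain ⟨n, rfl⟩ := Int.le.dest hij
  induction n with
  | zero => simpa using hj
  | succ n ih =>
    exact ih (by omega) (TopNonzero.of_succ hg hx0 hg0 h (by
      rwa [show i + n + 1 = i + ((n + 1 : ℕ) : ℤ) by push_cast; ring]))

/-- If nonvanishing of the top local cohomology is detected by a fraction of denominator
`(f g) ^ t`, it is also detected by fractions of denominator any higher power. -/
theorem exists_notMem_span_pow_of_le {f g : A} {d d' : ℕ} (hf : f ∈ 𝒜 d) (hg : g ∈ 𝒜 d')
    (hf0 : f ≠ 0) (hg0 : g ≠ 0) (h : IsRegularModulo f g) {j : ℤ} {t t' : ℕ} (htt' : t ≤ t') {a : A}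
    (ha : a ∈ intPart 𝒜 (j + t * (d + d' : ℕ))) (hna : a ∉ Ideal.span {f ^ t, g ^ t}) :
    ∃ a ∈ intPart 𝒜 (j + t' * (d + d' : ℕ)), a ∉ Ideal.span {f ^ t', g ^ t'} := by
  obtain ⟨s, rfl⟩ := Nat.exists_eq_add_of_le htt'
  refine ⟨(f * g) ^ s * a, mul_mem_intPart (d := s * (d + d')) ?_ ha (by push_cast; ring), ?_⟩
  · simpa using SetLike.pow_mem_graded s (SetLike.mul_mem_graded hf hg)
  · intro hmem
    exact hna (h.mem_span_of_mul_mem hf0 hg0 (by rwa [mul_comm]))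

end Shift

/-! ### Frobenius and gradings -/

section Frobenius

variable {k B : Type*} [Field k] [CommRing B] [Algebra k B] (p e : ℕ) [ExpChar B p]
  (ℬ : ℕ → Submodule k B) [GradedAlgebra ℬ]

theorem decompose_pow_expChar_pow (b : B) (n : ℕ) :
    (decompose ℬ (b ^ p ^ e) (p ^ e * n) : B) = (decompose ℬ b n : B) ^ p ^ e := by
  have hq : 0 < p ^ e := Nat.pow_pos (expChar_pos B p)
  induction b using Decomposition.inductionOn ℬ with
  | zero => rw [zero_pow hq.ne']; simp [zero_pow hq.ne']
  | @homogeneous i b =>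
    have hb : (b : B) ^ p ^ e ∈ ℬ (p ^ e * i) := by
      simpa using SetLike.pow_mem_graded (p ^ e) b.2
    by_cases h : i = n
    · subst h
      rw [decompose_of_mem_same ℬ hb, decompose_of_mem_same ℬ b.2]
    · rw [decompose_of_mem_ne ℬ hb (fun h' => h (Nat.eq_of_mul_eq_mul_left hq h')),
        decompose_of_mem_ne ℬ b.2 h, zero_pow hq.ne']
  | add b b' hb hb' =>
    simp only [add_pow_expChar_pow, decompose_add, DirectSum.add_apply, Submodule.coe_add, hb, hb']

theorem decompose_pow_expChar_pow_of_not_dvd (b : B) {n : ℕ} (hn : ¬ p ^ e ∣ n) :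
    (decompose ℬ (b ^ p ^ e) n : B) = 0 := by
  have hq : 0 < p ^ e := Nat.pow_pos (expChar_pos B p)
  induction b using Decomposition.inductionOn ℬ with
  | zero => rw [zero_pow hq.ne']; simp
  | @homogeneous i b =>
    have hb : (b : B) ^ p ^ e ∈ ℬ (p ^ e * i) := by
      simpa using SetLike.pow_mem_graded (p ^ e) b.2
    exact decompose_of_mem_ne ℬ hb fun h => hn ⟨i, h.symm⟩
  | add b b' hb hb' =>
    simp only [add_pow_expChar_pow, decompose_add, DirectSum.add_apply, Submodule.coe_add, hb, hb',
      add_zero]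

theorem pow_expChar_pow_injective [IsReduced B] : Function.Injective fun b : B => b ^ p ^ e :=
  iterateFrobenius_inj B p e

/-- The root of a homogeneous element of degree `p ^ e * n` is homogeneous of degree `n`. -/
theorem mem_of_pow_expChar_pow_mem [IsReduced B] {b : B} {n : ℕ} (hb : b ^ p ^ e ∈ ℬ (p ^ e * n)) :
    b ∈ ℬ n := by
  have : b ^ p ^ e = (decompose ℬ b n : B) ^ p ^ e := by
    rw [← decompose_pow_expChar_pow, decompose_of_mem_same ℬ hb]
  rw [pow_expChar_pow_injective p e this]
  exact SetLike.coe_mem _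

end Frobenius

/-! ### Homogeneous extensions -/

section Homogeneous

variable {k A B : Type*} [Field k] [CommRing A] [Algebra k A] [CommRing B] [Algebra k B]
  [Algebra A B] {𝒜 : ℕ → Submodule k A} [GradedAlgebra 𝒜] {ℬ : ℕ → Submodule k B} [GradedAlgebra ℬ]

theorem decompose_algebraMap (hhom : ∀ i, ∀ a ∈ 𝒜 i, algebraMap A B a ∈ ℬ i) (a : A) (n : ℕ) :
    (decompose ℬ (algebraMap A B a) n : B) = algebraMap A B (decompose 𝒜 a n) := by
  induction a using Decomposition.inductionOn 𝒜 with
  | zero => simp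
  | @homogeneous i a =>
    by_cases h : i = n
    · subst h
      rw [decompose_of_mem_same ℬ (hhom _ _ a.2), decompose_of_mem_same 𝒜 a.2]
    · rw [decompose_of_mem_ne ℬ (hhom _ _ a.2) h, decompose_of_mem_ne 𝒜 a.2 h, map_zero]
  | add a a' ha ha' =>
    simp only [map_add, decompose_add, DirectSum.add_apply, Submodule.coe_add, ha, ha']

theorem mem_of_algebraMap_mem (hhom : ∀ i, ∀ a ∈ 𝒜 i, algebraMap A B a ∈ ℬ i)
    (hinj : Function.Injective (algebraMap A B)) {a : A} {n : ℕ} (ha : algebraMap A B a ∈ ℬ n) :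
    a ∈ 𝒜 n := by
  have := decompose_algebraMap hhom a n
  rw [decompose_of_mem_same ℬ ha] at this
  rw [hinj this]
  exact SetLike.coe_mem _

omit [GradedAlgebra ℬ] in
/-- If the `p ^ e`-th power map identifies `ℬ n` with `𝒜 (p ^ e * n)` for all `n`, then the top
local cohomology of `B` in degree `j` corresponds to that of `A` in degree `p ^ e * j`. -/
theorem topNonzero_iff_of_frobenius [IsDomain A] [IsDomain B] (p e : ℕ) [ExpChar B p]
    (hinj : Function.Injective (algebraMap A B))
    (hpow : ∀ n, ∀ b ∈ ℬ n, ∃ a ∈ 𝒜 (p ^ e * n), algebraMap A B a = b ^ p ^ e)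
    (hroot : ∀ n, ∀ a ∈ 𝒜 (p ^ e * n), ∃ b ∈ ℬ n, b ^ p ^ e = algebraMap A B a)
    (hpow' : ∀ b : B, ∃ a : A, algebraMap A B a = b ^ p ^ e)
    {f g : A} {d d' : ℕ} (hf : f ∈ 𝒜 d) (hg : g ∈ 𝒜 d') (hf0 : f ≠ 0) (hg0 : g ≠ 0)
    (h : IsRegularModulo f g) (j : ℤ) :
    TopNonzero ℬ (algebraMap A B f) (algebraMap A B g) (d + d') j ↔
      TopNonzero 𝒜 f g (d + d') ((p ^ e : ℕ) * j) := by
  have hq : 0 < p ^ e := Nat.pow_pos (expChar_pos B p)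
  constructor
  · rintro ⟨t, b, hb, hnb⟩
    rcases mem_intPart_cases hb with rfl | ⟨n, hn, hb⟩
    · exact absurd (zero_mem _) hnb
    obtain ⟨a, ha, hab⟩ := hpow n b hb
    refine ⟨p ^ e * t, a, mem_intPart_of_eq ?_ ha, fun hmem => hnb ?_⟩
    · rw [Nat.cast_mul, hn]
      push_cast
      ring
    -- homogeneous coefficients of `b ^ p ^ e` have degrees divisible by `p ^ e`, so they have roots
    have coeff_root : ∀ c : ℕ, ∀ u ∈ intPart 𝒜 (((p ^ e * n : ℕ) : ℤ) - (p ^ e * t * c : ℕ)),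
        ∃ v : B, v ^ p ^ e = algebraMap A B u := by
      intro c u hu
      rcases mem_intPart_cases hu with rfl | ⟨m, hm, hu⟩
      · exact ⟨0, by rw [zero_pow hq.ne', map_zero]⟩
      · have hm' : m + p ^ e * (t * c) = p ^ e * n := by
          rw [← mul_assoc]
          omega
        obtain ⟨r, rfl⟩ : p ^ e ∣ m := by
          rw [Nat.dvd_add_iff_left (Dvd.intro _ rfl), hm']
          exact Dvd.intro _ rfl
        obtain ⟨v, -, hv⟩ := hroot r u hu
        exact ⟨v, hv⟩
    obtain ⟨u, hu, v, hv, huv⟩ := exists_homogeneous_coeff_pair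
      (SetLike.pow_mem_graded (p ^ e * t) hf) (SetLike.pow_mem_graded (p ^ e * t) hg)
      (mem_intPart_of_eq rfl ha) hmem
    obtain ⟨u', hu'⟩ := coeff_root d u hu
    obtain ⟨v', hv'⟩ := coeff_root d' v hv
    refine Ideal.mem_span_pair.2 ⟨u', v', pow_expChar_pow_injective p e ?_⟩
    simp only
    rw [← hab, huv, add_pow_expChar_pow, mul_pow, mul_pow, hu', hv', map_add, map_mul, map_mul,
      map_pow, map_pow]
    ring
  · rintro ⟨t, a, ha, hna⟩
    obtain ⟨a, ha, hna⟩ := exists_notMem_span_pow_of_le hf hg hf0 hg0 h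
      (Nat.le_mul_of_pos_left t hq) ha hna
    rcases mem_intPart_cases ha with rfl | ⟨m, hm, ha⟩
    · exact absurd (zero_mem _) hna
    have hm' : (m : ℤ) = (p ^ e : ℕ) * (j + t * (d + d' : ℕ)) := by
      rw [hm]
      push_cast
      ring
    obtain ⟨n, rfl⟩ : p ^ e ∣ m := Int.natCast_dvd_natCast.1 ⟨_, hm'⟩
    have hn : (n : ℤ) = j + t * (d + d' : ℕ) := by
      have : ((p ^ e : ℕ) : ℤ) ≠ 0 := by exact_mod_cast hq.ne'
      rw [Nat.cast_mul] at hm'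
      exact mul_left_cancel₀ this hm'
    obtain ⟨b, hb, hba⟩ := hroot n a ha
    refine ⟨t, b, mem_intPart_of_eq hn hb, fun hmem => hna ?_⟩
    obtain ⟨u, v, huv⟩ := Ideal.mem_span_pair.1 hmem
    obtain ⟨u', hu'⟩ := hpow' u
    obtain ⟨v', hv'⟩ := hpow' v
    refine Ideal.mem_span_pair.2 ⟨u', v', hinj ?_⟩
    rw [← hba, ← huv, add_pow_expChar_pow, mul_pow, mul_pow, map_add, map_mul, map_mul, hu', hv',
      map_pow, map_pow]
    ring

end Homogeneous

/-! ### Veronese subalgebras -/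

section Veronese

variable {k A : Type*} [Field k] [CommRing A] [Algebra k A]
  {𝒜 : ℕ → Submodule k A} [GradedAlgebra 𝒜]

theorem mem_veronese_iff {n : ℕ} {a : A} :
    a ∈ veronese 𝒜 n ↔ ∀ j, ¬ n ∣ j → (decompose 𝒜 a j : A) = 0 := by
  change a ∈ ⨆ i : ℕ, 𝒜 (n * i) ↔ _
  constructor
  · intro ha j hj
    induction ha using Submodule.iSup_induction' with
    | zero => simp
    | mem i x hx => exact decompose_of_mem_ne 𝒜 hx fun h => hj ⟨i, h.symm⟩
    | add x y _ _ hx hy => simp [hx, hy]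
  · intro h
    classical
    rw [← sum_support_decompose 𝒜 a]
    refine sum_mem fun j _ => ?_
    by_cases hj : n ∣ j
    · obtain ⟨i, rfl⟩ := hj
      exact Submodule.mem_iSup_of_mem i (SetLike.coe_mem _)
    · rw [h j hj]
      exact zero_mem _

theorem mem_veronese_of_mem {n i : ℕ} {a : A} (ha : a ∈ 𝒜 (n * i)) : a ∈ veronese 𝒜 n :=
  mem_veronese_iff.2 fun _ hj => decompose_of_mem_ne 𝒜 ha fun h => hj ⟨i, h.symm⟩

/-- If `x` is linear, the powers `x ^ i` with `i < n` are linearly independent over `A^(n)`: their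
multiples live in different degrees modulo `n`. -/
theorem eq_zero_of_sum_mul_pow_eq_zero [IsDomain A] {n : ℕ} {x : A} (hx : x ∈ 𝒜 1) (hx0 : x ≠ 0)
    {c : Fin n → A} (hc : ∀ i, c i ∈ veronese 𝒜 n)
    (hsum : ∑ i, c i * x ^ (i : ℕ) = 0) (i : Fin n) : c i = 0 := by
  have hxp : ∀ i, x ^ i ∈ 𝒜 i := fun i => by simpa using SetLike.pow_mem_graded i hx
  apply (decompose 𝒜).injective
  rw [decompose_zero]
  ext m
  rw [DirectSum.zero_apply, ZeroMemClass.coe_zero]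
  by_cases hm : n ∣ m
  · have h := congrArg (fun y => (decompose 𝒜 y (m + i) : A)) hsum
    simp only [coe_decompose_sum, decompose_zero, DirectSum.zero_apply, ZeroMemClass.coe_zero] at h
    rw [Fintype.sum_eq_single i,
      coe_decompose_mul_add_of_right_mem 𝒜 (hxp i)] at h
    · exact (mul_eq_zero.1 h).resolve_right (pow_ne_zero _ hx0)
    · intro l hli
      by_cases hle : (l : ℕ) ≤ m + i
      · rw [coe_decompose_mul_of_right_mem_of_le 𝒜 (hxp l) hle,
          mem_veronese_iff.1 (hc l), zero_mul]
        rintro ⟨r, hr⟩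
        obtain ⟨s, rfl⟩ := hm
        have h1 : (i : ℕ) ≡ l [MOD n] := by
          have : n * r + l = n * s + i := by omega
          have h2 : (n * r + l) % n = (n * s + i) % n := by rw [this]
          simpa [Nat.ModEq] using h2.symm
        exact hli (Fin.ext (Nat.ModEq.eq_of_lt_of_lt h1 i.2 l.2).symm)
      · exact coe_decompose_mul_of_right_mem_of_not_le 𝒜 (hxp l) hle
  · exact mem_veronese_iff.1 (hc i) m hm

/-- An element of `A` which is a quotient of two elements of `A^(n)` lies in `A^(n)`. -/
theorem mem_veronese_of_mul_mem [IsDomain A] {n : ℕ} {a t : A} (ht : t ∈ veronese 𝒜 n)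
    (ht0 : t ≠ 0) (hat : t * a ∈ veronese 𝒜 n) : a ∈ veronese 𝒜 n := by
  classical
  -- split `a` into its part `a'` in degrees divisible by `n` and the rest `a''`; then `t * a'' = 0`
  set a' : A := ∑ i ∈ (decompose 𝒜 a).support with n ∣ i, (decompose 𝒜 a i : A)
  set a'' : A := ∑ i ∈ (decompose 𝒜 a).support with ¬ n ∣ i, (decompose 𝒜 a i : A) with ha''
  have hsplit : a = a' + a'' := by
    conv_lhs => rw [← sum_support_decompose 𝒜 a]
    exact (Finset.sum_filter_add_sum_filter_not _ _ _).symm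
  have ha' : a' ∈ veronese 𝒜 n := sum_mem fun i hi => by
    obtain ⟨j, rfl⟩ := (Finset.mem_filter.1 hi).2
    exact mem_veronese_of_mem (SetLike.coe_mem _)
  have hta : t * a'' ∈ veronese 𝒜 n := by
    have : t * a'' = t * a - t * a' := by rw [hsplit]; ring
    rw [this]
    exact sub_mem hat (mul_mem ht ha')
  have hzero : ∀ j, n ∣ j → (decompose 𝒜 (t * a'') j : A) = 0 := by
    intro j hj
    rw [ha'', Finset.mul_sum, coe_decompose_sum]
    refine Finset.sum_eq_zero fun i hi => ?_
    by_cases hle : i ≤ j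
    · rw [coe_decompose_mul_of_right_mem_of_le 𝒜 (SetLike.coe_mem _) hle,
        mem_veronese_iff.1 ht, zero_mul]
      exact fun h => (Finset.mem_filter.1 hi).2 ((Nat.dvd_sub_iff_right hle hj).1 h)
    · exact coe_decompose_mul_of_right_mem_of_not_le 𝒜 (SetLike.coe_mem _) hle
  have hta0 : t * a'' = 0 := by
    rw [← sum_support_decompose 𝒜 (t * a'')]
    refine Finset.sum_eq_zero fun j _ => ?_
    by_cases hj : n ∣ j
    · exact hzero j hj
    · exact mem_veronese_iff.1 hta j hj
  rw [hsplit, (mul_eq_zero.1 hta0).resolve_left ht0, add_zero]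
  exact ha'

end Veronese

/-! ### Degrees of subfields of powers -/

section PDegree

variable {L : Type*} [Field L]

theorem relfinrank_pos_and_le {F M : Subfield L} (h : F ≤ M) (U : IntermediateField F L)
    [FiniteDimensional F U] (hU : ∀ z ∈ M, z ∈ U) :
    0 < F.relfinrank M ∧ F.relfinrank M ≤ Module.finrank F U := by
  rw [Subfield.relfinrank_eq_finrank_of_le h]
  have hle : Subalgebra.toSubmodule (Subfield.extendScalars h).toSubalgebra ≤
      Subalgebra.toSubmodule U.toSubalgebra := hU
  have : FiniteDimensional F (Subfield.extendScalars h) := Submodule.finiteDimensional_of_le hle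
  exact ⟨Module.finrank_pos, Submodule.finrank_mono (M := L) hle⟩

theorem finrank_adjoin_simple_le_of_pow_mem {F : Subfield L} {x : L} {n : ℕ} (hn : 0 < n)
    (hx : x ^ n ∈ F) : FiniteDimensional F (IntermediateField.adjoin F {x}) ∧
      Module.finrank F (IntermediateField.adjoin F {x}) ≤ n := by
  have hmonic := Polynomial.monic_X_pow_sub_C (⟨x ^ n, hx⟩ : F) hn.ne'
  have hroot : Polynomial.aeval x (Polynomial.X ^ n - Polynomial.C (⟨x ^ n, hx⟩ : F)) = 0 := by
    simp [show algebraMap F L ⟨x ^ n, hx⟩ = x ^ n from rfl]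
  have hint : IsIntegral F x := ⟨_, hmonic, hroot⟩
  refine ⟨IntermediateField.adjoin.finiteDimensional hint, ?_⟩
  rw [IntermediateField.adjoin.finrank hint]
  refine (Polynomial.natDegree_le_of_dvd (minpoly.dvd F x hroot) hmonic.ne_zero).trans ?_
  rw [Polynomial.natDegree_X_pow_sub_C]

/-- Let `L` be purely inseparable of degree `q = p ^ e` over `M`, where `M` is finite over a field
generated by two elements over a perfect field. Then `[M : L ^ q] ≤ q`: for `E = k(x, y)` one has
`[M : E ^ q] = [M : E] [E : E ^ q] ≤ [M : E] q ^ 2`, and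
`[M : E ^ q] = [M : L ^ q] [L ^ q : M ^ q] [M ^ q : E ^ q] = [M : L ^ q] q [M : E]`. -/
theorem relfinrank_fieldRange_iterateFrobenius_le {k : Type*} [Field k] [PerfectField k]
    [Algebra k L] (p e : ℕ) [ExpChar k p] [ExpChar L p] {M : Subfield L}
    (hdeg : Module.finrank M L = p ^ e)
    (hM : ∀ z : L, z ^ p ^ e ∈ M) {x y : L}
    (hE : (IntermediateField.adjoin k {x, y}).toSubfield ≤ M)
    {S : Set L} [Finite S]
    (hS : ∀ s ∈ S, IsIntegral (IntermediateField.adjoin k {x, y}).toSubfield s)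
    (hMS : M ≤ (IntermediateField.adjoin (IntermediateField.adjoin k {x, y}).toSubfield
      S).toSubfield) :
    0 < (iterateFrobenius L p e).fieldRange.relfinrank M ∧
      (iterateFrobenius L p e).fieldRange.relfinrank M ≤ p ^ e := by
  have hq : 0 < p ^ e := Nat.pow_pos (expChar_pos L p)
  set E := (IntermediateField.adjoin k {x, y}).toSubfield with hEdef
  set φ := iterateFrobenius L p e with hφ
  have hφ_apply : ∀ z, φ z = z ^ p ^ e := iterateFrobenius_def p e
  have hEE : E.map φ ≤ E := by
    rintro _ ⟨z, hz, rfl⟩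
    rw [hφ_apply]
    exact pow_mem hz _
  have hxE : x ∈ E := IntermediateField.subset_adjoin k _ (by simp)
  have hyE : y ∈ E := IntermediateField.subset_adjoin k _ (by simp)
  have hφL : φ.fieldRange ≤ M := by
    rintro _ ⟨z, rfl⟩
    rw [hφ_apply]
    exact hM z
  have h1 : 0 < E.relfinrank M := by
    have := IntermediateField.finiteDimensional_adjoin hS
    exact (relfinrank_pos_and_le hE (IntermediateField.adjoin E S) hMS).1
  have h2 : 0 < (E.map φ).relfinrank E ∧ (E.map φ).relfinrank E ≤ p ^ e * p ^ e := by
    obtain ⟨hx1, hx2⟩ := finrank_adjoin_simple_le_of_pow_mem (F := E.map φ) hq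
      ⟨x, hxE, hφ_apply x⟩
    obtain ⟨hy1, hy2⟩ := finrank_adjoin_simple_le_of_pow_mem (F := E.map φ) hq
      ⟨y, hyE, hφ_apply y⟩
    have hsup := relfinrank_pos_and_le hEE
      (IntermediateField.adjoin (E.map φ) {x} ⊔ IntermediateField.adjoin (E.map φ) {y}) (by
        suffices E ≤ (IntermediateField.adjoin (E.map φ) {x} ⊔
          IntermediateField.adjoin (E.map φ) {y}).toSubfield from this
        rw [hEdef]
        refine IntermediateField.adjoin_le_subfield k _ ?_ ?_
        · -- the constants are `p ^ e`-th powers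
          rintro _ ⟨c, rfl⟩
          obtain ⟨b, rfl⟩ := (bijective_iterateFrobenius k p e).2 c
          refine IntermediateField.algebraMap_mem _ (⟨algebraMap k L (iterateFrobenius k p e b),
            algebraMap k L b, IntermediateField.algebraMap_mem _ b, ?_⟩ : E.map φ)
          rw [hφ_apply, iterateFrobenius_def, map_pow]
        · rintro z (rfl | rfl)
          · exact (le_sup_left : _ ≤ (IntermediateField.adjoin (E.map φ) {z} ⊔
              IntermediateField.adjoin (E.map φ) {y}))
              (IntermediateField.mem_adjoin_simple_self _ _)
          · exact (le_sup_right : _ ≤ (IntermediateField.adjoin (E.map φ) {x} ⊔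
              IntermediateField.adjoin (E.map φ) {z}))
              (IntermediateField.mem_adjoin_simple_self _ _))
    exact ⟨hsup.1, hsup.2.trans ((IntermediateField.finrank_sup_le _ _).trans
      (Nat.mul_le_mul hx2 hy2))⟩
  have e1 := Subfield.relfinrank_mul_relfinrank hEE hE
  have hEM : E.map φ ≤ M.map φ := by
    rintro _ ⟨z, hz, rfl⟩
    exact ⟨z, hE hz, rfl⟩
  have hML : M.map φ ≤ φ.fieldRange := by
    rintro _ ⟨z, hz, rfl⟩
    exact ⟨z, rfl⟩
  have e2 := Subfield.relfinrank_mul_relfinrank hEM hML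
  have e3 := Subfield.relfinrank_mul_relfinrank (hEM.trans hML) hφL
  have e4 : (M.map φ).relfinrank φ.fieldRange = p ^ e := by
    rw [RingHom.fieldRange_eq_map, Subfield.relfinrank_map_map, Subfield.relfinrank_top_right, hdeg]
  rw [Subfield.relfinrank_map_map, e4] at e2
  rw [← e2, ← e1] at e3
  set n := E.relfinrank M
  set m := (E.map φ).relfinrank E
  set r := φ.fieldRange.relfinrank M
  constructor
  · refine Nat.pos_of_ne_zero fun hr => ?_
    rw [hr, mul_zero] at e3
    exact (Nat.mul_pos h2.1 h1).ne e3
  · have h3 : (n * p ^ e) * r ≤ (n * p ^ e) * p ^ e := by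
      rw [e3]
      calc m * n ≤ (p ^ e * p ^ e) * n := Nat.mul_le_mul_right _ h2.2
        _ = n * p ^ e * p ^ e := by ring
    exact Nat.le_of_mul_le_mul_left h3 (Nat.mul_pos h1 hq)

/-- Independent powers `x ^ i`, `i < q`, form a basis if the degree is at most `q`. -/
theorem exists_eq_sum_mul_pow {F M : Subfield L} (hFM : F ≤ M) {q : ℕ}
    (hrank : 0 < F.relfinrank M ∧ F.relfinrank M ≤ q) {x : L} (hx : x ∈ M)
    (hli : LinearIndependent F fun i : Fin q => x ^ (i : ℕ)) {y : L} (hy : y ∈ M) :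
    ∃ c : Fin q → F, y = ∑ i, (c i : L) * x ^ (i : ℕ) := by
  rw [Subfield.relfinrank_eq_finrank_of_le hFM] at hrank
  set N := Subfield.extendScalars hFM
  have hfin : FiniteDimensional F N := Module.finite_of_finrank_pos hrank.1
  let b : Fin q → N := fun i => ⟨x ^ (i : ℕ), pow_mem hx _⟩
  have hb : LinearIndependent F b := LinearIndependent.of_comp N.val.toLinearMap hli
  have hcard : Fintype.card (Fin q) = Module.finrank F N :=
    le_antisymm hb.fintype_card_le_finrank (by simpa using hrank.2)
  have hspan := hb.span_eq_top_of_card_eq_finrank' hcard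
  have hmem : (⟨y, hy⟩ : N) ∈ Submodule.span F (Set.range b) := by
    rw [hspan]; trivial
  obtain ⟨c, hc⟩ := (Submodule.mem_span_range_iff_exists_fun F).1 hmem
  refine ⟨c, ?_⟩
  have := congrArg (fun z : N => (z : L)) hc.symm
  simpa [b, Subfield.smul_def] using this

end PDegree

/-! ### Powers in purely inseparable extensions -/

section PurelyInseparable

theorem pow_mem_range_of_isPurelyInseparable {K L : Type*} [Field K] [Field L] [Algebra K L]
    [IsPurelyInseparable K L] (p e : ℕ) [Fact p.Prime] [ExpChar K p]
    (hdeg : Module.finrank K L = p ^ e) (z : L) : ∃ w : K, algebraMap K L w = z ^ p ^ e := by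
  have hp : p.Prime := Fact.out
  have hfin : FiniteDimensional K L :=
    Module.finite_of_finrank_pos (hdeg ▸ Nat.pow_pos hp.pos)
  obtain ⟨n, y, hy⟩ := IsPurelyInseparable.minpoly_eq_X_pow_sub_C K p z
  have hn : p ^ n ∣ p ^ e := by
    have h1 := IntermediateField.adjoin.finrank (IsIntegral.of_finite K z)
    rw [hy, Polynomial.natDegree_X_pow_sub_C] at h1
    rw [← h1, ← hdeg]
    exact Dvd.intro _ (Module.finrank_mul_finrank K (IntermediateField.adjoin K {z}) L)
  obtain ⟨m, hm⟩ := hn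
  have hz := minpoly.aeval K z
  rw [hy] at hz
  simp only [map_sub, map_pow, Polynomial.aeval_X, Polynomial.aeval_C] at hz
  exact ⟨y ^ m, by rw [hm, pow_mul, sub_eq_zero.1 hz, map_pow]⟩

/-- If `L / K` is purely inseparable of degree `p ^ e` and `A` is normal, then `b ^ (p ^ e)` is
integral over `A` and lies in `K`, hence in `A`. -/
theorem exists_algebraMap_eq_pow {A B K L : Type*} [CommRing A] [IsDomain A] [CommRing B]
    [IsDomain B] [Algebra A B] [Algebra.IsIntegral A B] [IsIntegrallyClosed A]
    [Field K] [Algebra A K] [IsFractionRing A K] [Field L] [Algebra B L] [IsFractionRing B L]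
    [Algebra K L] [Algebra A L] [IsScalarTower A K L] [IsScalarTower A B L]
    [IsPurelyInseparable K L] (p e : ℕ) [Fact p.Prime] [ExpChar K p]
    (hdeg : Module.finrank K L = p ^ e) (b : B) : ∃ a : A, algebraMap A B a = b ^ p ^ e := by
  obtain ⟨w, hw⟩ := pow_mem_range_of_isPurelyInseparable p e hdeg (algebraMap B L b)
  have hint : IsIntegral A w := by
    rw [← isIntegral_algebraMap_iff (B := L) (algebraMap K L).injective, hw, ← map_pow]
    exact (Algebra.IsIntegral.isIntegral (R := A) (b ^ p ^ e)).algebraMap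
  obtain ⟨a, rfl⟩ := IsIntegrallyClosed.isIntegral_iff.1 hint
  refine ⟨a, IsFractionRing.injective B L ?_⟩
  rw [map_pow, ← hw, ← IsScalarTower.algebraMap_apply, ← IsScalarTower.algebraMap_apply]

end PurelyInseparable

/-! ### The quotient field of the Veronese subalgebra -/

section Birational

variable {k A B K L : Type*} [Field k] [CommRing A] [IsDomain A] [Algebra k A]
  [CommRing B] [IsDomain B] [Algebra k B] [Algebra A B]
  {𝒜 : ℕ → Submodule k A} [GradedAlgebra 𝒜] {ℬ : ℕ → Submodule k B} [GradedAlgebra ℬ]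

omit [IsDomain A] [IsDomain B] in
theorem mem_veronese_of_algebraMap_eq_pow (p e : ℕ) [ExpChar B p]
    (hinj : Function.Injective (algebraMap A B))
    (hhom : ∀ i, ∀ a ∈ 𝒜 i, algebraMap A B a ∈ ℬ i) {a : A} {b : B}
    (hab : algebraMap A B a = b ^ p ^ e) : a ∈ veronese 𝒜 (p ^ e) := by
  refine mem_veronese_iff.2 fun j hj => hinj ?_
  rw [← decompose_algebraMap hhom, hab, decompose_pow_expChar_pow_of_not_dvd p e ℬ b hj, map_zero]

/-- An expansion `y = ∑ zᵢ ^ q x ^ i`, `q = p ^ e`, of an element `y` of `A^(q)`, with `zᵢ` in the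
quotient field of `B`, involves `z₀` only. After clearing denominators, the summands lie in
different degrees modulo `q`. -/
theorem eq_pow_of_eq_sum_pow_mul_pow [Field L] [Algebra B L] [IsFractionRing B L] (p e : ℕ)
    [ExpChar B p] (hinj : Function.Injective (algebraMap A B))
    (hhom : ∀ i, ∀ a ∈ 𝒜 i, algebraMap A B a ∈ ℬ i)
    (hpow : ∀ b : B, ∃ a : A, algebraMap A B a = b ^ p ^ e)
    {x : A} (hx : x ∈ 𝒜 1) (hx0 : x ≠ 0) {y : A} (hy : y ∈ veronese 𝒜 (p ^ e))
    {z : Fin (p ^ e) → L} (hyz : algebraMap B L (algebraMap A B y) =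
      ∑ i, z i ^ p ^ e * algebraMap B L (algebraMap A B x) ^ (i : ℕ)) (i : Fin (p ^ e)) :
    (i : ℕ) = 0 ∧ algebraMap B L (algebraMap A B y) = z i ^ p ^ e ∨ (i : ℕ) ≠ 0 ∧ z i = 0 := by
  have hq : 0 < p ^ e := Nat.pow_pos (expChar_pos B p)
  have hBL := IsFractionRing.injective B L
  obtain ⟨⟨s, hs⟩, hsz⟩ := IsLocalization.exist_integer_multiples_of_finite (nonZeroDivisors B) z
  have hs0 : algebraMap B L s ^ p ^ e ≠ 0 :=
    pow_ne_zero _ ((map_ne_zero_iff _ hBL).2 (nonZeroDivisors.ne_zero hs))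
  choose b hb using hsz
  simp only [Algebra.smul_def] at hb
  obtain ⟨s', hs'⟩ := hpow s
  choose a ha using fun i => hpow (b i)
  have haz : ∀ i, algebraMap B L (algebraMap A B (a i)) = algebraMap B L s ^ p ^ e * z i ^ p ^ e :=
    fun i => by rw [ha, map_pow, hb, mul_pow]
  let c : Fin (p ^ e) → A := fun i => a i - if (i : ℕ) = 0 then s' * y else 0
  have hc : ∀ i, c i ∈ veronese 𝒜 (p ^ e) := by
    intro i
    refine sub_mem (mem_veronese_of_algebraMap_eq_pow p e hinj hhom (ha i)) ?_
    split_ifs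
    · exact mul_mem (mem_veronese_of_algebraMap_eq_pow p e hinj hhom hs') hy
    · exact zero_mem _
  have hsplit : ∑ i, c i * x ^ (i : ℕ) = ∑ i, a i * x ^ (i : ℕ) - s' * y := by
    simp only [c, sub_mul, Finset.sum_sub_distrib]
    congr 1
    rw [Fintype.sum_eq_single (⟨0, hq⟩ : Fin (p ^ e))]
    · simp
    · intro i hi
      rw [if_neg fun h => hi (Fin.ext h), zero_mul]
  have hsum : ∑ i, c i * x ^ (i : ℕ) = 0 := by
    apply hinj
    apply hBL
    simp only [hsplit, map_sub, map_sum, map_mul, map_pow, map_zero, haz, hs']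
    rw [hyz, Finset.mul_sum, sub_eq_zero]
    exact Finset.sum_congr rfl fun i _ => by ring
  have hci := eq_zero_of_sum_mul_pow_eq_zero hx hx0 hc hsum i
  by_cases hi : (i : ℕ) = 0
  · refine Or.inl ⟨hi, mul_left_cancel₀ hs0 ?_⟩
    simp only [c, if_pos hi, sub_eq_zero] at hci
    rw [← haz, hci, map_mul, map_mul, hs', map_pow]
  · refine Or.inr ⟨hi, ?_⟩
    simp only [c, if_neg hi, sub_zero] at hci
    have := haz i
    rw [hci, map_zero, map_zero, eq_comm, mul_eq_zero] at this
    exact pow_eq_zero_iff hq.ne' |>.1 (this.resolve_left hs0)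

variable [Algebra.IsIntegral A B] [IsIntegrallyClosed A] [IsNoetherianRing A]
  [Module.Finite k (𝒜 0)] [PerfectField k]
  [Field K] [Algebra A K] [IsFractionRing A K] [Field L] [Algebra B L] [IsFractionRing B L]
  [Algebra K L] [Algebra A L] [IsScalarTower A K L] [IsScalarTower A B L]
  [IsPurelyInseparable K L] (p e : ℕ) [Fact p.Prime] [ExpChar k p] [ExpChar B p] [ExpChar K p]
  [ExpChar L p]

/-- `A^(q) ⊆ L ^ q` with `q = p ^ e`, so that `A^(q)` and `B ^ q` have the same quotient field. The
powers `x ^ i`, `i < q`, of a linear form are independent over `L ^ q`, over which the image of `K`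
has degree at most `q`; so they form a basis, in which elements of `A^(q)` have only a constant
coefficient. -/
theorem exists_eq_pow_of_mem_veronese (hdim : ringKrullDim A = 2)
    (hinj : Function.Injective (algebraMap A B))
    (hhom : ∀ i, ∀ a ∈ 𝒜 i, algebraMap A B a ∈ ℬ i)
    (hlin : ∃ x ∈ 𝒜 1, x ≠ 0) (hdeg : Module.finrank K L = p ^ e)
    {y : A} (hy : y ∈ veronese 𝒜 (p ^ e)) :
    ∃ z : L, algebraMap B L (algebraMap A B y) = z ^ p ^ e := by
  have hq : 0 < p ^ e := Nat.pow_pos (expChar_pos B p)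
  have hpow : ∀ b : B, ∃ a : A, algebraMap A B a = b ^ p ^ e :=
    exists_algebraMap_eq_pow (K := K) (L := L) p e hdeg
  have hAL : Function.Injective (algebraMap A L) := by
    rw [IsScalarTower.algebraMap_eq A B L]
    exact (IsFractionRing.injective B L).comp hinj
  obtain ⟨x, hx, hx0⟩ := hlin
  have hdim' : ¬ ringKrullDim A ≤ 1 := by
    rw [hdim]
    decide
  obtain ⟨d, g, hg, hrad⟩ := exists_radical_eq_irrelevant hdim one_pos hx hx0
  have hg0 := ne_zero_of_radical_eq (f := g) hdim' hx (by rwa [Set.pair_comm])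
  have hd : 0 < d := degree_pos_of_mem_irrelevant hg hg0
    (hrad ▸ Ideal.le_radical (Ideal.subset_span (by simp)))
  have hrange : Set.range ![x, g] = {x, g} := by simp [Matrix.range_cons, Set.pair_comm]
  have hfinite := finite_adjoin_of_radical_eq 𝒜 (f := ![x, g]) (d := ![1, d])
    (by intro i; fin_cases i <;> simp [hd]) (by intro i; fin_cases i <;> simpa)
    (by rw [hrange]; exact hrad)
  rw [hrange] at hfinite
  -- `A` is finite over `k[x, g]`, so the image `M` of `K` in `L` is finite over `E = k(x, g)`
  let _ : Algebra k L := ((algebraMap A L).comp (algebraMap k A)).toAlgebra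
  let ψ : A →ₐ[k] L := { algebraMap A L with commutes' := fun _ => rfl }
  have hψ : ∀ a, ψ a = algebraMap A L a := fun _ => rfl
  set E := IntermediateField.adjoin k {ψ x, ψ g} with hE
  have hCE : Algebra.adjoin k {x, g} ≤ E.toSubalgebra.comap ψ := by
    rw [Algebra.adjoin_le_iff]
    rintro z (rfl | rfl)
    exacts [IntermediateField.subset_adjoin k _ (by simp),
      IntermediateField.subset_adjoin k _ (by simp)]
  have hint : ∀ a : A, IsIntegral E.toSubfield (ψ a) := by
    intro a
    let i : Algebra.adjoin k {x, g} →+* E.toSubfield :=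
      ((ψ : A →+* L).comp (Algebra.adjoin k {x, g}).val.toRingHom).codRestrict E.toSubfield
        fun c => hCE c.2
    exact (Algebra.IsIntegral.isIntegral (R := Algebra.adjoin k {x, g}) a).map_of_comp_eq i
      (ψ : A →+* L) rfl
  set M : Subfield L := (algebraMap K L).fieldRange with hM
  have hAM : ∀ a, ψ a ∈ M := fun a =>
    ⟨algebraMap A K a, (IsScalarTower.algebraMap_apply A K L a).symm⟩
  have hEM : E.toSubfield ≤ M := by
    refine IntermediateField.adjoin_le_subfield k _ ?_ ?_
    · rintro _ ⟨c, rfl⟩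
      exact hAM (algebraMap k A c)
    · rintro z (rfl | rfl)
      exacts [hAM _, hAM _]
  have hMdeg : Module.finrank M L = p ^ e := by
    rw [← hdeg]
    exact (Algebra.finrank_eq_of_equiv_equiv
      (RingEquiv.ofBijective (algebraMap K L).rangeRestrictField
        ⟨(algebraMap K L).rangeRestrictField.injective, by
        rintro ⟨_, w, rfl⟩; exact ⟨w, rfl⟩⟩) (RingEquiv.refl L) rfl).symm
  have hMpow : ∀ z : L, z ^ p ^ e ∈ M := pow_mem_range_of_isPurelyInseparable p e hdeg
  obtain ⟨S, hS⟩ : (⊤ : Subalgebra k A).FG := (finiteType_of_isNoetherianRing 𝒜).out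
  have hMS : M ≤ (IntermediateField.adjoin E.toSubfield (ψ '' S)).toSubfield := by
    set T := IntermediateField.adjoin E.toSubfield (ψ '' S)
    have hAT : ∀ a, ψ a ∈ T := by
      intro a
      have ha : a ∈ Algebra.adjoin k (S : Set A) := hS ▸ Algebra.mem_top
      induction ha using Algebra.adjoin_induction with
      | mem a ha => exact IntermediateField.subset_adjoin _ _ ⟨a, ha, rfl⟩
      | algebraMap c =>
        exact IntermediateField.algebraMap_mem T
          (⟨ψ (algebraMap k A c), E.algebraMap_mem c⟩ : E.toSubfield)
      | add a b _ _ ha hb => rw [map_add]; exact add_mem ha hb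
      | mul a b _ _ ha hb => rw [map_mul]; exact mul_mem ha hb
    rintro _ ⟨w, rfl⟩
    obtain ⟨a, b, -, rfl⟩ := IsFractionRing.div_surjective (A := A) w
    rw [map_div₀, ← IsScalarTower.algebraMap_apply, ← IsScalarTower.algebraMap_apply]
    exact div_mem (hAT a) (hAT b)
  have hrank := relfinrank_fieldRange_iterateFrobenius_le (k := k) p e hMdeg hMpow
    (x := ψ x) (y := ψ g) hEM (S := ψ '' S) (by rintro _ ⟨a, -, rfl⟩; exact hint a) hMS
  have hFM : (iterateFrobenius L p e).fieldRange ≤ M := by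
    rintro _ ⟨z, rfl⟩
    exact hMpow z
  have htower : ∀ a, ψ a = algebraMap B L (algebraMap A B a) :=
    fun a => IsScalarTower.algebraMap_apply A B L a
  have hli : LinearIndependent (iterateFrobenius L p e).fieldRange
      fun i : Fin (p ^ e) => ψ x ^ (i : ℕ) := by
    rw [Fintype.linearIndependent_iff]
    intro c hc i
    choose z hz using fun i => (c i).2
    have h0 := eq_pow_of_eq_sum_pow_mul_pow (L := L) (ℬ := ℬ) p e hinj hhom hpow hx hx0
      (y := 0) (zero_mem _) (z := z) (by
        rw [map_zero, map_zero, ← hc]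
        refine Finset.sum_congr rfl fun i _ => ?_
        rw [Subfield.smul_def, ← hz, ← htower]
        rfl) i
    apply Subtype.ext
    rw [← hz, iterateFrobenius_def]
    rcases h0 with ⟨-, h0⟩ | ⟨-, h0⟩
    · rw [← h0, map_zero, map_zero]; rfl
    · rw [h0, zero_pow hq.ne']; rfl
  obtain ⟨c, hc⟩ := exists_eq_sum_mul_pow hFM hrank (hAM x) hli (hAM y)
  choose z hz using fun i => (c i).2
  rcases eq_pow_of_eq_sum_pow_mul_pow (L := L) (ℬ := ℬ) p e hinj hhom hpow hx hx0 hy (z := z) (by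
    rw [← htower, ← htower, hc]
    exact Finset.sum_congr rfl fun i _ => by rw [← hz, iterateFrobenius_def]) ⟨0, hq⟩ with h | h
  · exact ⟨_, h.2⟩
  · exact absurd rfl h.1

end Birational

/-! ### The subring of powers -/

section Subrings

variable {k B : Type*} [Field k] [CommRing B] [Algebra k B] (p e : ℕ) [Fact p.Prime] [CharP k p]

theorem mem_frobeniusPower_iff [Nontrivial B] {b : B} :
    b ∈ frobeniusPower k B p e ↔ ∃ c : B, c ^ p ^ e = b := by
  have : ExpChar B p := expChar_of_injective_algebraMap (algebraMap k B).injective p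
  exact Iff.rfl

theorem isNoetherianRing_frobeniusPower [Nontrivial B] [IsNoetherianRing B] :
    IsNoetherianRing (frobeniusPower k B p e) := by
  have : ExpChar B p := expChar_of_injective_algebraMap (algebraMap k B).injective p
  exact isNoetherianRing_of_surjective B (iterateFrobenius B p e).range
    (iterateFrobenius B p e).rangeRestrict (iterateFrobenius B p e).rangeRestrict_surjective

/-- An algebra of finite type over a perfect field is finite over its subring of `p ^ e`-th
powers. -/
theorem finite_frobeniusPower [Nontrivial B] [PerfectField k] [Algebra.FiniteType k B] :
    Module.Finite (frobeniusPower k B p e) B := by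
  have hp : p.Prime := Fact.out
  have hk : ExpChar k p := expChar_of_injective_algebraMap (algebraMap k k).injective p
  obtain ⟨S, hS⟩ := (inferInstance : Algebra.FiniteType k B).out
  have hft : Algebra.FiniteType (frobeniusPower k B p e) B := by
    refine ⟨⟨S, eq_top_iff.2 fun b _ => ?_⟩⟩
    have hb : b ∈ Algebra.adjoin k (S : Set B) := hS ▸ Algebra.mem_top
    induction hb using Algebra.adjoin_induction with
    | mem a ha => exact Algebra.subset_adjoin ha
    | algebraMap c =>
      obtain ⟨d, rfl⟩ := (bijective_iterateFrobenius k p e).2 c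
      refine Subalgebra.algebraMap_mem _ (⟨algebraMap k B (iterateFrobenius k p e d),
        (mem_frobeniusPower_iff p e).2 ⟨algebraMap k B d, ?_⟩⟩ : frobeniusPower k B p e)
      rw [iterateFrobenius_def, map_pow]
    | add a b _ _ ha hb => exact add_mem (ha Algebra.mem_top) (hb Algebra.mem_top)
    | mul a b _ _ ha hb => exact mul_mem (ha Algebra.mem_top) (hb Algebra.mem_top)
  have hint : Algebra.IsIntegral (frobeniusPower k B p e) B := by
    refine ⟨fun b => IsIntegral.of_pow (Nat.pow_pos (n := e) hp.pos) ?_⟩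
    exact isIntegral_algebraMap (R := frobeniusPower k B p e)
      (x := ⟨b ^ p ^ e, (mem_frobeniusPower_iff p e).2 ⟨b, rfl⟩⟩)
  exact Algebra.IsIntegral.finite

theorem isFiniteBirational_of_fractions [IsDomain B] [IsNoetherianRing B] [PerfectField k]
    [Algebra.FiniteType k B] {T : Subring B} (hle : frobeniusPower k B p e ≤ T)
    (hT : ∀ t ∈ T, ∃ b c : B, c ≠ 0 ∧ c ^ p ^ e * t = b ^ p ^ e) :
    IsFiniteBirational (frobeniusPower k B p e) T := by
  have hp : p.Prime := Fact.out
  refine ⟨hle, ?_, RingHom.injective _, ?_⟩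
  · have := isNoetherianRing_frobeniusPower (k := k) (B := B) p e
    have := finite_frobeniusPower (k := k) (B := B) p e
    let _ : Algebra (frobeniusPower k B p e) T := (Subring.inclusion hle).toAlgebra
    let i : T →ₗ[frobeniusPower k B p e] B :=
      { toFun := fun t => t
        map_add' := fun _ _ => rfl
        map_smul' := fun _ _ => rfl }
    exact Module.Finite.of_injective i Subtype.val_injective
  · set j := (IsFractionRing.map (Subring.inclusion_injective hle) :
      FractionRing (frobeniusPower k B p e) →+* FractionRing T)
    have hj : ∀ s, j (algebraMap _ _ s) = algebraMap T (FractionRing T) (Subring.inclusion hle s) :=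
      fun s => IsLocalization.map_eq _ s
    have hmem : ∀ t : T, algebraMap T (FractionRing T) t ∈ j.fieldRange := by
      rintro ⟨t, ht⟩
      obtain ⟨b, c, hc, hbc⟩ := hT t ht
      have hc' : (⟨c ^ p ^ e, hle ((mem_frobeniusPower_iff p e).2 ⟨c, rfl⟩)⟩ : T) ≠ 0 := fun h =>
        hc (pow_eq_zero_iff (Nat.pow_pos (n := e) hp.pos).ne' |>.1 (congrArg Subtype.val h))
      have heq : algebraMap T (FractionRing T) ⟨t, ht⟩ =
          j (algebraMap (frobeniusPower k B p e) _
            ⟨b ^ p ^ e, (mem_frobeniusPower_iff p e).2 ⟨b, rfl⟩⟩) /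
          j (algebraMap (frobeniusPower k B p e) _
            ⟨c ^ p ^ e, (mem_frobeniusPower_iff p e).2 ⟨c, rfl⟩⟩) := by
        rw [hj, hj, eq_div_iff, ← map_mul]
        · congr 1
          apply Subtype.ext
          simpa [mul_comm] using hbc
        · exact (map_ne_zero_iff _ (IsFractionRing.injective T (FractionRing T))).2 hc'
      rw [heq]
      exact div_mem ⟨_, rfl⟩ ⟨_, rfl⟩
    intro w
    obtain ⟨t, s, -, rfl⟩ := IsFractionRing.div_surjective (A := T) w
    exact div_mem (hmem t) (hmem s)

end Subrings

/-! ### Normality and `a`-invariants of the extension -/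

section Normality

variable {k A B K L : Type*} [Field k] [CommRing A] [IsDomain A] [Algebra k A]
  [CommRing B] [IsDomain B] [Algebra k B] [Algebra A B]
  {𝒜 : ℕ → Submodule k A} [GradedAlgebra 𝒜] {ℬ : ℕ → Submodule k B} [GradedAlgebra ℬ]

/-- If every element of `A^(q)`, `q = p ^ e`, has a `q`-th root in `B`, then `B` is normal: for `z`
integral over `B`, the power `z ^ q` is integral over `A`, lies in `K`, hence in `A`, and there in
`A^(q)`. -/
theorem isIntegrallyClosed_of_exists_root [Algebra.IsIntegral A B] [IsIntegrallyClosed A]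
    [Field K] [Algebra A K] [IsFractionRing A K] [Field L] [Algebra B L] [IsFractionRing B L]
    [Algebra K L] [Algebra A L] [IsScalarTower A K L] [IsScalarTower A B L]
    (p e : ℕ) [ExpChar B p] (hinj : Function.Injective (algebraMap A B))
    (hhom : ∀ i, ∀ a ∈ 𝒜 i, algebraMap A B a ∈ ℬ i)
    (hpow : ∀ b : B, ∃ a : A, algebraMap A B a = b ^ p ^ e)
    (hroot : ∀ a ∈ veronese 𝒜 (p ^ e), ∃ b : B, b ^ p ^ e = algebraMap A B a) :
    IsIntegrallyClosed B := by
  have hq : 0 < p ^ e := Nat.pow_pos (expChar_pos B p)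
  have hBL := IsFractionRing.injective B L
  have htower : ∀ a, algebraMap K L (algebraMap A K a) = algebraMap B L (algebraMap A B a) :=
    fun a => by rw [← IsScalarTower.algebraMap_apply, ← IsScalarTower.algebraMap_apply]
  rw [isIntegrallyClosed_iff L]
  intro z hz
  obtain ⟨b, c, hc, rfl⟩ := IsFractionRing.div_surjective (A := B) z
  have hc0 : c ≠ 0 := nonZeroDivisors.ne_zero hc
  have hcL : algebraMap B L c ≠ 0 := (map_ne_zero_iff _ hBL).2 hc0
  obtain ⟨a, ha⟩ := hpow b
  obtain ⟨s, hs⟩ := hpow c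
  have hs0 : s ≠ 0 := by
    rintro rfl
    rw [map_zero] at hs
    exact hc0 (pow_eq_zero_iff hq.ne' |>.1 hs.symm)
  have hsK : algebraMap A K s ≠ 0 := (map_ne_zero_iff _ (IsFractionRing.injective A K)).2 hs0
  have heq : algebraMap K L (algebraMap A K a / algebraMap A K s) =
      (algebraMap B L b / algebraMap B L c) ^ p ^ e := by
    rw [map_div₀, htower, htower, ha, hs, map_pow, map_pow, div_pow]
  have hint : IsIntegral A (algebraMap A K a / algebraMap A K s) := by
    rw [← isIntegral_algebraMap_iff (B := L) (algebraMap K L).injective, heq]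
    exact (isIntegral_trans (R := A) (A := B) _ hz).pow _
  obtain ⟨y, hy⟩ := IsIntegrallyClosed.isIntegral_iff.1 hint
  have hsy : s * y = a := by
    apply IsFractionRing.injective A K
    rw [map_mul, hy, mul_div_cancel₀ _ hsK]
  have hyV : y ∈ veronese 𝒜 (p ^ e) := mem_veronese_of_mul_mem
    (mem_veronese_of_algebraMap_eq_pow p e hinj hhom hs) hs0
    (hsy ▸ mem_veronese_of_algebraMap_eq_pow p e hinj hhom ha)
  obtain ⟨w, hw⟩ := hroot y hyV
  refine ⟨w, ?_⟩
  rw [eq_div_iff hcL, ← map_mul]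
  congr 1
  apply pow_expChar_pow_injective p e
  simp only
  rw [mul_pow, hw, ← hs, ← ha, ← hsy, map_mul, mul_comm]

omit [IsDomain A] in
/-- A homogeneous system of parameters of `A` is one of `B`. -/
theorem radical_eq_irrelevant_of_pow_mem (p e : ℕ) [ExpChar B p]
    (hinj : Function.Injective (algebraMap A B))
    (hhom : ∀ i, ∀ a ∈ 𝒜 i, algebraMap A B a ∈ ℬ i)
    (hpow : ∀ b : B, ∃ a : A, algebraMap A B a = b ^ p ^ e) {f g : A} {d d' : ℕ} (hd : 0 < d)
    (hd' : 0 < d') (hf : f ∈ 𝒜 d) (hg : g ∈ 𝒜 d')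
    (hrad : (Ideal.span {f, g}).radical = (HomogeneousIdeal.irrelevant 𝒜).toIdeal) :
    (Ideal.span {algebraMap A B f, algebraMap A B g}).radical =
      (HomogeneousIdeal.irrelevant ℬ).toIdeal := by
  have hq : 0 < p ^ e := Nat.pow_pos (expChar_pos B p)
  apply le_antisymm
  · refine irrelevant_isPrime.radical_le_iff.2 (Ideal.span_le.2 ?_)
    rintro y (rfl | rfl)
    exacts [mem_irrelevant_of_mem_pos hd (hhom _ _ hf), mem_irrelevant_of_mem_pos hd' (hhom _ _ hg)]
  · intro b hb
    obtain ⟨a, ha⟩ := hpow b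
    have hairr : a ∈ (HomogeneousIdeal.irrelevant 𝒜).toIdeal := by
      change a ∈ HomogeneousIdeal.irrelevant 𝒜
      rw [HomogeneousIdeal.mem_irrelevant_iff, GradedRing.proj_apply]
      apply hinj
      have hb0 := (HomogeneousIdeal.mem_irrelevant_iff ℬ b).1 hb
      rw [GradedRing.proj_apply] at hb0
      have h0 := decompose_pow_expChar_pow p e ℬ b 0
      rw [mul_zero] at h0
      rw [← decompose_algebraMap hhom, ha, h0, hb0, zero_pow hq.ne', map_zero]
    rw [← hrad] at hairr
    obtain ⟨n, hn⟩ := hairr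
    obtain ⟨u, v, huv⟩ := Ideal.mem_span_pair.1 hn
    refine ⟨p ^ e * n, Ideal.mem_span_pair.2 ⟨algebraMap A B u, algebraMap A B v, ?_⟩⟩
    rw [pow_mul, ← ha, ← map_pow, ← huv, map_add, map_mul, map_mul]

/-- The formula for `a`-invariants. With `H_j` denoting the degree `j` part of the top local
cohomology, `H_j(B) ≅ H_{qj}(A)` by Frobenius, and `H_i(A) ≠ 0` exactly for `i ≤ a(A)`, since a
linear form acts surjectively; so `H_j(B) ≠ 0` if and only if `q j ≤ a(A)`. -/
theorem exists_isAInvariant_floor_eq [IsNoetherianRing A] [IsIntegrallyClosed A]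
    [Module.Finite k (𝒜 0)] [IsNoetherianRing B] [IsIntegrallyClosed B] [Module.Finite k (ℬ 0)]
    (hdimA : ringKrullDim A = 2) (hdimB : ringKrullDim B = 2) (p e : ℕ) [ExpChar B p]
    (hinj : Function.Injective (algebraMap A B))
    (hhom : ∀ i, ∀ a ∈ 𝒜 i, algebraMap A B a ∈ ℬ i) (hlin : ∃ x ∈ 𝒜 1, x ≠ 0)
    (hpow : ∀ b : B, ∃ a : A, algebraMap A B a = b ^ p ^ e)
    (hroot : ∀ a ∈ veronese 𝒜 (p ^ e), ∃ b : B, b ^ p ^ e = algebraMap A B a) :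
    ∃ a b : ℤ, IsAInvariant 𝒜 a ∧ IsAInvariant ℬ b ∧ ⌊(a : ℚ) / (p : ℚ) ^ e⌋ = b := by
  have hq : 0 < p ^ e := Nat.pow_pos (expChar_pos B p)
  have hdim' : ¬ ringKrullDim A ≤ 1 := by
    rw [hdimA]
    decide
  obtain ⟨x, hx, hx0⟩ := hlin
  obtain ⟨d, g, hg, hrad⟩ := exists_radical_eq_irrelevant hdimA one_pos hx hx0
  have hg0 := ne_zero_of_radical_eq (f := g) hdim' hx (by rwa [Set.pair_comm])
  have hd : 0 < d := degree_pos_of_mem_irrelevant hg hg0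
    (hrad ▸ Ideal.le_radical (Ideal.subset_span (by simp)))
  have hreg := isRegularModulo_of_radical_eq hdim' hx hg hrad
  have hradB := radical_eq_irrelevant_of_pow_mem p e hinj hhom hpow one_pos hd hx hg hrad
  obtain ⟨N, hN⟩ := exists_isTopDegree hrad
  obtain ⟨N', hN'⟩ := exists_isTopDegree hradB
  refine ⟨_, _, isAInvariant_of_isTopDegree hdimA hx hg hrad hN,
    isAInvariant_of_isTopDegree hdimB (hhom _ _ hx) (hhom _ _ hg) hradB hN', ?_⟩
  have hA := hN.isGreatest_topNonzero hx hg
  have hB := hN'.isGreatest_topNonzero (hhom _ _ hx) (hhom _ _ hg)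
  set a : ℤ := (N : ℤ) - (1 : ℕ) - d
  set b : ℤ := (N' : ℤ) - (1 : ℕ) - d
  have hAiff : ∀ i, TopNonzero 𝒜 x g (1 + d) i ↔ i ≤ a :=
    fun i => ⟨fun h => hA.2 h, fun h => TopNonzero.of_le hg hx0 hg0 hreg h hA.1⟩
  have hBiff : ∀ j, TopNonzero ℬ (algebraMap A B x) (algebraMap A B g) (1 + d) j ↔
      (p ^ e : ℕ) * j ≤ a := by
    intro j
    rw [← hAiff]
    refine topNonzero_iff_of_frobenius p e hinj ?_ ?_ hpow hx hg hx0 hg0 hreg j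
    · intro n y hy
      obtain ⟨c, hc⟩ := hpow y
      refine ⟨c, mem_of_algebraMap_mem hhom hinj ?_, hc⟩
      rw [hc]
      simpa using SetLike.pow_mem_graded (p ^ e) hy
    · intro n c hc
      obtain ⟨y, hy⟩ := hroot c (mem_veronese_of_mem hc)
      exact ⟨y, mem_of_pow_expChar_pow_mem p e ℬ (hy ▸ hhom _ _ hc), hy⟩
  have h1 : (p ^ e : ℕ) * b ≤ a := (hBiff b).1 hB.1
  have h2 : a < (p ^ e : ℕ) * (b + 1) := by
    by_contra! h
    have := hB.2 ((hBiff (b + 1)).2 h)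
    omega
  have hqQ : (0 : ℚ) < (p : ℚ) ^ e := by exact_mod_cast hq
  rw [Int.floor_eq_iff, le_div_iff₀ hqQ, div_lt_iff₀ hqQ]
  constructor
  · rw [mul_comm]
    exact_mod_cast h1
  · rw [mul_comm]
    exact_mod_cast h2

end Normality

theorem mainTheorem6 {k A B K L : Type*} [Field k] [PerfectField k]
    (p e : ℕ) [Fact p.Prime] [CharP k p]
    [CommRing A] [IsDomain A] [IsNoetherianRing A] [Algebra k A]
    [CommRing B] [IsDomain B] [IsNoetherianRing B] [Algebra k B]
    (𝒜 : ℕ → Submodule k A) [GradedAlgebra 𝒜] [Module.Finite k (𝒜 0)]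
    (ℬ : ℕ → Submodule k B) [GradedAlgebra ℬ] [Module.Finite k (ℬ 0)]
    (hdimA : ringKrullDim A = 2) (hdimB : ringKrullDim B = 2)
    [Algebra A B] [IsScalarTower k A B] [Algebra.IsIntegral A B]
    (hinj : Function.Injective (algebraMap A B))
    (hhom : ∀ i, ∀ a ∈ 𝒜 i, algebraMap A B a ∈ ℬ i)
    [IsIntegrallyClosed A] (hlin : ∃ x ∈ 𝒜 1, x ≠ 0)
    [Field K] [Algebra A K] [IsFractionRing A K]
    [Field L] [Algebra B L] [IsFractionRing B L]
    [Algebra K L] [Algebra A L] [IsScalarTower A K L] [IsScalarTower A B L]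
    [IsPurelyInseparable K L] (hdeg : Module.finrank K L = p ^ e) :
    IsFiniteBirational (frobeniusPower k B p e)
        ((veronese 𝒜 (p ^ e)).toSubring.map (algebraMap A B)) ∧
      (IsIntegrallyClosed B ↔
        frobeniusPower k B p e = (veronese 𝒜 (p ^ e)).toSubring.map (algebraMap A B)) ∧
      (IsIntegrallyClosed B →
        ∃ a b : ℤ, IsAInvariant 𝒜 a ∧ IsAInvariant ℬ b ∧ ⌊(a : ℚ) / (p : ℚ) ^ e⌋ = b) := by
  have hp : p.Prime := Fact.out
  have hq : 0 < p ^ e := Nat.pow_pos hp.pos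
  have hk : ExpChar k p := expChar_of_injective_algebraMap (algebraMap k k).injective p
  have hB : ExpChar B p := expChar_of_injective_algebraMap (algebraMap k B).injective p
  have hK : ExpChar K p := expChar_of_injective_ringHom
    (f := (algebraMap A K).comp (algebraMap k A)) (RingHom.injective _) p
  have hL : ExpChar L p := expChar_of_injective_algebraMap (algebraMap K L).injective p
  have hBL := IsFractionRing.injective B L
  have hpow : ∀ b : B, ∃ a : A, algebraMap A B a = b ^ p ^ e :=
    exists_algebraMap_eq_pow (K := K) (L := L) p e hdeg
  have hle : frobeniusPower k B p e ≤ (veronese 𝒜 (p ^ e)).toSubring.map (algebraMap A B) := by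
    intro c hc
    obtain ⟨b, rfl⟩ := (mem_frobeniusPower_iff p e).1 hc
    obtain ⟨a, ha⟩ := hpow b
    exact ⟨a, mem_veronese_of_algebraMap_eq_pow p e hinj hhom ha, ha⟩
  have hroot_L : ∀ a ∈ veronese 𝒜 (p ^ e), ∃ z : L, algebraMap B L (algebraMap A B a) = z ^ p ^ e :=
    fun a ha => exists_eq_pow_of_mem_veronese (K := K) (ℬ := ℬ) p e hdimA hinj hhom hlin hdeg ha
  have hroot : IsIntegrallyClosed B →
      ∀ a ∈ veronese 𝒜 (p ^ e), ∃ b : B, b ^ p ^ e = algebraMap A B a := by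
    intro _ a ha
    obtain ⟨z, hz⟩ := hroot_L a ha
    obtain ⟨b, rfl⟩ := IsIntegrallyClosed.exists_algebraMap_eq_of_isIntegral_pow (R := B) hq
      (hz ▸ isIntegral_algebraMap)
    exact ⟨b, hBL (by rw [map_pow, hz])⟩
  refine ⟨?_, ⟨fun hnormal => le_antisymm hle ?_, fun heq => ?_⟩, fun hnormal => ?_⟩
  · have := finiteType_of_isNoetherianRing ℬ
    refine isFiniteBirational_of_fractions p e hle ?_
    rintro _ ⟨a, ha, rfl⟩
    obtain ⟨z, hz⟩ := hroot_L a ha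
    obtain ⟨b, c, hc, rfl⟩ := IsFractionRing.div_surjective (A := B) z
    have hc0 : algebraMap B L c ≠ 0 :=
      (map_ne_zero_iff _ hBL).2 (nonZeroDivisors.ne_zero hc)
    refine ⟨b, c, nonZeroDivisors.ne_zero hc, hBL ?_⟩
    rw [map_mul, map_pow, map_pow, hz, div_pow, mul_div_cancel₀ _ (pow_ne_zero _ hc0)]
  · rintro _ ⟨a, ha, rfl⟩
    exact (mem_frobeniusPower_iff p e).2 (hroot hnormal a ha)
  · refine isIntegrallyClosed_of_exists_root (K := K) (L := L) (𝒜 := 𝒜) (ℬ := ℬ) p e hinj hhom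
      hpow ?_
    intro a ha
    exact (mem_frobeniusPower_iff (k := k) p e).1 (heq ▸ ⟨a, ha, rfl⟩)
  · exact exists_isAInvariant_floor_eq hdimA hdimB p e hinj hhom hlin hpow (hroot hnormal)
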